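/- Let $d\in\mathbb N$, let $\Omega=C_0([0,1];\mathbb R^d)$ be the space of continuous paths starting at $0$, let $\nu$ be the Wiener measure on $\Omega$, and let $\mathbb H$ be the Cameron--Martin space of absolutely continuous $h:[0,1]\to\mathbb R^d$ with $h(0)=0$ and $h'\in L^2$, with $\langle h,k\rangle_{\mathbb H}=\int_0^1\langle h'(x),k'(x)\rangle_{\mathbb R^d}\,dx$. Let $Z$ be the linear space of all functions $F(\gamma)=f(\gamma(s_1),\dots,\gamma(s_k))$ on $\Omega$ with $k\ge 1$, $0<s_1<\dots<s_k=1$, and $f:(\mathbb R^d)^k\to\mathbb R$ smooth such that $f$ and all its partial derivatives have at most polynomial growth. For such $F$ put $$D_sF(\gamma)=\sum_{i=1}^k (s_i\wedge s)\,(\nabla_{s_i}f)(\gamma(s_1),\dots,\gamma(s_k)),\qquad s\in[0,1],$$ where $\nabla_{s_i}$ is the gradient in the $i$-th variable (so $DF(\gamma)\in\mathbb H$). (1) Let $\varphi:\Omega\to\mathbb R$ be measurable with $0<\varphi\le c$ $\nu$-a.e. for some constant $c$, and suppose that $F/\varphi\in L^1(\nu)$ for all $F\in Z$. Then $Z\subset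 L^2(\varphi\nu)$, the form $$\mathscr D(F,G)=\frac12\int\langle DF,DG\rangle_{\mathbb H}\,\varphi\,d\nu,\qquad F,G\in Z,$$ is well defined (the integrand is integrable), and $(\mathscr D,Z)$ is closable on $L^2(\varphi\nu)$: if $u_n\in Z$, $u_n\to0$ in $L^2(\varphi\nu)$ and $\mathscr D(u_n-u_m,u_n-u_m)\to0$ as $n,m\to\infty$, then $\mathscr D(u_n,u_n)\to0$. (2) In the case $\varphi\equiv1$, every $F\in Z$, $F(\gamma)=f(\gamma(s_1),\dots,\gamma(s_k))$, belongs to the domain of the generator $L$ of the closure of $(\mathscr D,Z)$ on $L^2(\nu)$, and $L$ acts on it as the Ornstein--Uhlenbeck operator $$LF(\gamma)=\frac12\sum_{i,j=1}^k(s_i\wedge s_j)\sum_{a=1}^d(\partial_{i,a}\partial_{j,a}f)(\gamma(s_1),\dots,\gamma(s_k))-\frac12\sum_{i=1}^k\big\langle\gamma(s_i),(\nabla_{s_i}f)(\gamma(s_1),\dots,\gamma(s_k))\big\rangle_{\mathbb R^d},$$ where $\partial_{i,a}$ is the derivative in the $a$-th coordinate of the $i$-th variable. -/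

import Mathlib

open MeasureTheory ProbabilityTheory Filter Topology
open scoped unitInterval

noncomputable section

namespace WienerForm

/-- The Euclidean space `ℝᵈ`. -/
abbrev Euc (d : ℕ) : Type := EuclideanSpace ℝ (Fin d)

/-- The path space `C₀([0,1]; ℝᵈ)` of continuous paths starting at the origin. -/
def Path (d : ℕ) : Type := {γ : C(I, Euc d) // γ 0 = 0}

instance (d : ℕ) : CoeFun (Path d) (fun _ => I → Euc d) := ⟨fun γ => γ.1⟩

/-- The σ-algebra generated by the coordinates `γ ↦ γ(t)`; it is the Borel σ-algebra of the
uniform topology. -/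
instance (d : ℕ) : MeasurableSpace (Path d) :=
  ⨆ t : I, MeasurableSpace.comap (fun γ : Path d => γ t) inferInstance

/-- `ν` is the Wiener measure: under `ν` the coordinate process (which is continuous and starts
at `0`) has independent increments, and `γ(t) - γ(s)` has law `N(0, (t - s) Id)` for `s ≤ t`. -/
structure IsWienerMeasure {d : ℕ} (ν : Measure (Path d)) : Prop where
  isProbabilityMeasure : IsProbabilityMeasure ν
  hasIndepIncrements : HasIndepIncrements (fun (t : I) (γ : Path d) => γ t) ν
  law_increment : ∀ s t : I, s ≤ t →
    ν.map (fun γ : Path d => γ t - γ s) =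
      (stdGaussian (Euc d)).map (fun x => Real.sqrt ((t : ℝ) - s) • x)

/-- Membership of `h : [0,1] → ℝᵈ` in the Cameron–Martin space: absolutely continuous,
`h 0 = 0`, with square integrable derivative. -/
structure IsCameronMartin {d : ℕ} (h : I → Euc d) : Prop where
  zero : h 0 = 0
  absolutelyContinuous : AbsolutelyContinuousOnInterval (Set.IccExtend zero_le_one h) 0 1
  memLp_deriv : MemLp (deriv (Set.IccExtend zero_le_one h)) 2 (volume.restrict (Set.Icc 0 1))

/-- The Cameron–Martin inner product `∫₀¹ ⟨h'(x), k'(x)⟩ dx`. -/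
def cmInner {d : ℕ} (h k : I → Euc d) : ℝ :=
  ∫ x in (0 : ℝ)..1,
    inner ℝ (deriv (Set.IccExtend zero_le_one h) x) (deriv (Set.IccExtend zero_le_one k) x)

/-- A presentation `F(γ) = f(γ(s₁), …, γ(s_k))` of a cylindrical function, with
`0 < s₁ < ⋯ < s_k = 1` (here `k = n + 1`) and `f` smooth, all of whose derivatives have
polynomial growth. -/
structure Cyl (d : ℕ) where
  n : ℕ
  s : Fin (n + 1) → I
  s_pos : ∀ i, 0 < s i
  s_strictMono : StrictMono s
  s_last : s (Fin.last n) = 1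
  f : (Fin (n + 1) → Euc d) → ℝ
  f_growth : Function.HasTemperateGrowth f

namespace Cyl

variable {d : ℕ} (r : Cyl d)

/-- The vector `(γ(s₁), …, γ(s_k))`. -/
def ev (γ : Path d) : Fin (r.n + 1) → Euc d := fun i => γ (r.s i)

/-- The cylindrical function `γ ↦ f(γ(s₁), …, γ(s_k))`. -/
def toFun (γ : Path d) : ℝ := r.f (r.ev γ)

/-- The gradient of `f` with respect to its `i`-th variable, the others being fixed. -/
def partialGrad (i : Fin (r.n + 1)) (x : Fin (r.n + 1) → Euc d) : Euc d :=
  gradient (fun y => r.f (Function.update x i y)) (x i)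

/-- `D_t F(γ) = ∑ᵢ (sᵢ ∧ t) (∇_{sᵢ} f)(γ)`. -/
def grad (γ : Path d) (t : I) : Euc d :=
  ∑ i, min (r.s i : ℝ) (t : ℝ) • r.partialGrad i (r.ev γ)

/-- The Ornstein–Uhlenbeck operator on cylindrical functions:
`LF(γ) = ½ ∑_{i,j} (sᵢ ∧ sⱼ) ∑ₐ (∂_{i,a} ∂_{j,a} f)(γ) - ½ ∑ᵢ ⟨γ(sᵢ), (∇_{sᵢ} f)(γ)⟩`,
where `∂_{i,a}` is the derivative in the `a`-th coordinate of the `i`-th variable. -/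
def ornsteinUhlenbeck (γ : Path d) : ℝ :=
  (1 / 2) * (∑ i, ∑ j, min (r.s i : ℝ) (r.s j : ℝ) *
      ∑ a : Fin d,
        fderiv ℝ (fun x => fderiv ℝ r.f x (Pi.single j (EuclideanSpace.single a 1)))
          (r.ev γ) (Pi.single i (EuclideanSpace.single a 1)))
    - (1 / 2) * (∑ i, inner ℝ (γ (r.s i)) (r.partialGrad i (r.ev γ)))

theorem inner_partialGrad (i : Fin (r.n + 1)) (x : Fin (r.n + 1) → Euc d) (v : Euc d) :
    inner ℝ (r.partialGrad i x) v = fderiv ℝ r.f x (Pi.single i v) := by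
  have hf : DifferentiableAt ℝ r.f (Function.update x i (x i)) :=
    (r.f_growth.1.differentiable (by simp)).differentiableAt
  have h := hf.hasFDerivAt.comp (x i) (hasFDerivAt_update x (x i))
  have h2 : HasFDerivAt (fun y => r.f (Function.update x i y)) _ (x i) := h
  rw [partialGrad, gradient, InnerProductSpace.toDual_symm_apply, h2.fderiv]
  simp only [ContinuousLinearMap.comp_apply, Function.update_eq_self]
  congr 1
  ext j : 1
  by_cases hj : j = i
  · subst hj; simp
  · simp [hj]

/-- The path `u ↦ (u ∧ t) v`. -/
def ramp (t : I) (v : Euc d) : C(I, Euc d) := ⟨fun u => min (u : ℝ) (t : ℝ) • v, by fun_prop⟩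

/-- The path `γ + ε (· ∧ t) v`. -/
def shift (γ : Path d) (t : I) (v : Euc d) (ε : ℝ) : Path d :=
  ⟨γ.1 + ε • ramp t v, by
    have h : min (0 : ℝ) (t : ℝ) = 0 := min_eq_left t.2.1
    rw [ContinuousMap.add_apply, γ.2, zero_add, ContinuousMap.smul_apply, ramp,
      ContinuousMap.coe_mk, Set.Icc.coe_zero, h, zero_smul, smul_zero]⟩

theorem hasDerivAt_shift (γ : Path d) (t : I) (v : Euc d) :
    HasDerivAt (fun ε => r.toFun (shift γ t v ε)) (inner ℝ (r.grad γ t) v) 0 := by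
  have hf : HasFDerivAt r.f (fderiv ℝ r.f (r.ev γ)) (r.ev γ) :=
    (r.f_growth.1.differentiable (by simp)).differentiableAt.hasFDerivAt
  have hl : HasDerivAt (fun ε : ℝ => r.ev γ + ε • (fun i => ramp t v (r.s i)))
      (fun i => ramp t v (r.s i)) 0 := by
    simpa using ((hasDerivAt_id (0 : ℝ)).smul_const (fun i => ramp t v (r.s i))).const_add (r.ev γ)
  have hf' : HasFDerivAt r.f (fderiv ℝ r.f (r.ev γ))
      (r.ev γ + (0 : ℝ) • (fun i => ramp t v (r.s i))) := by simpa using hf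
  have h := hf'.comp_hasDerivAt (0 : ℝ) hl
  have e : fderiv ℝ r.f (r.ev γ) (fun i => ramp t v (r.s i)) = inner ℝ (r.grad γ t) v := by
    rw [grad, sum_inner]
    simp_rw [inner_smul_left, inner_partialGrad]
    have : (fun i => ramp t v (r.s i)) =
        ∑ i, min (r.s i : ℝ) (t : ℝ) • (Pi.single i v : Fin (r.n + 1) → Euc d) := by
      ext j : 1
      simp [Finset.sum_apply, Pi.single_apply, ramp]
    rw [this, map_sum]
    simp
  rw [e] at h
  exact h

/-- The gradient depends only on the function, not on its presentation. -/
theorem grad_eq_of_toFun_eq {r r' : Cyl d} (h : r.toFun = r'.toFun) : r.grad = r'.grad := by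
  funext γ t
  refine ext_inner_right ℝ fun v => ?_
  have h1 := r.hasDerivAt_shift γ t v
  rw [h] at h1
  exact h1.unique (r'.hasDerivAt_shift γ t v)

theorem isCameronMartin_grad (γ : Path d) : IsCameronMartin (r.grad γ) := by
  have hL : ∃ K, LipschitzWith K (Set.IccExtend (zero_le_one (α := ℝ)) (r.grad γ)) := by
    have hs : ∀ i, LipschitzWith 1 (fun t : I => min (r.s i : ℝ) (t : ℝ)) := by
      intro i
      have h : LipschitzWith 1 (fun x : ℝ => min ((r.s i : ℝ)) x) :=
        LipschitzWith.id.const_min _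
      have h2 := h.comp (LipschitzWith.subtype_val (Set.Icc (0 : ℝ) 1))
      rw [mul_one] at h2
      exact h2
    have hg : ∃ K, LipschitzWith K (r.grad γ) := by
      refine ⟨∑ i, ‖r.partialGrad i (r.ev γ)‖₊, LipschitzWith.of_dist_le_mul fun t u => ?_⟩
      rw [dist_eq_norm, grad, grad, ← Finset.sum_sub_distrib, NNReal.coe_sum, Finset.sum_mul]
      refine norm_sum_le_of_le _ fun i _ => ?_
      rw [← sub_smul, norm_smul, mul_comm]
      have h := (hs i).dist_le_mul t u
      rw [NNReal.coe_one, one_mul, Real.dist_eq] at h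
      exact mul_le_mul_of_nonneg_left h (norm_nonneg _)
    obtain ⟨K, hK⟩ := hg
    exact ⟨K * 1, hK.comp (LipschitzWith.projIcc zero_le_one)⟩
  obtain ⟨K, hK⟩ := hL
  refine ⟨?_, hK.lipschitzOnWith.absolutelyContinuousOnInterval, ?_⟩
  · have h : ∀ i, min (r.s i : ℝ) 0 = 0 := fun i => min_eq_right (r.s i).2.1
    simp only [grad, Set.Icc.coe_zero, h, zero_smul, Finset.sum_const_zero]
  · refine MemLp.of_bound (measurable_deriv _).aestronglyMeasurable K ?_
    exact ae_of_all _ fun x => norm_deriv_le_of_lipschitz hK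

/-- Every presentation can be refined to a larger finite set of times. -/
theorem exists_refine (r r' : Cyl d) : ∃ (n : ℕ) (t : Fin (n + 1) → I)
    (τ : Fin (r.n + 1) → Fin (n + 1)) (τ' : Fin (r'.n + 1) → Fin (n + 1)),
    (∀ i, 0 < t i) ∧ StrictMono t ∧ t (Fin.last n) = 1 ∧
      (∀ i, t (τ i) = r.s i) ∧ ∀ i, t (τ' i) = r'.s i := by
  classical
  set T : Finset I := Finset.univ.image r.s ∪ Finset.univ.image r'.s with hT
  have h1 : (1 : I) ∈ T := by
    rw [hT, Finset.mem_union, Finset.mem_image]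
    exact Or.inl ⟨_, Finset.mem_univ _, r.s_last⟩
  obtain ⟨n, hn⟩ : ∃ n, T.card = n + 1 :=
    Nat.exists_eq_succ_of_ne_zero (Finset.card_ne_zero_of_mem h1)
  have hr : ∀ x ∈ T, ∃ i, T.orderEmbOfFin hn i = x := by
    intro x hx
    have : x ∈ Set.range (T.orderEmbOfFin hn) := by
      rw [Finset.range_orderEmbOfFin]; exact hx
    exact this
  choose τ hτ using fun i => hr (r.s i) (by simp [hT])
  choose τ' hτ' using fun i => hr (r'.s i) (by simp [hT])
  refine ⟨n, T.orderEmbOfFin hn, τ, τ', fun i => ?_, (T.orderEmbOfFin hn).strictMono, ?_, hτ, hτ'⟩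
  · have hi := T.orderEmbOfFin_mem hn i
    generalize T.orderEmbOfFin hn i = x at hi ⊢
    rw [hT, Finset.mem_union, Finset.mem_image, Finset.mem_image] at hi
    rcases hi with ⟨j, -, hj⟩ | ⟨j, -, hj⟩
    · exact hj ▸ r.s_pos j
    · exact hj ▸ r'.s_pos j
  · obtain ⟨i, hi⟩ := hr 1 h1
    refine le_antisymm (Subtype.coe_le_coe.1 (T.orderEmbOfFin hn _).2.2) ?_
    rw [← hi]
    exact (T.orderEmbOfFin hn).monotone (Fin.le_last i)

end Cyl

/-- The linear space `Z` of smooth cylindrical functions of polynomial growth. -/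
def Z (d : ℕ) : Submodule ℝ (Path d → ℝ) where
  carrier := Set.range Cyl.toFun
  zero_mem' := ⟨⟨0, fun _ => 1, by simp, by intro a b h; omega, rfl, fun _ => 0,
    Function.HasTemperateGrowth.const 0⟩, rfl⟩
  add_mem' := by
    rintro _ _ ⟨r, rfl⟩ ⟨r', rfl⟩
    obtain ⟨n, t, τ, τ', hpos, hmono, hlast, h, h'⟩ := Cyl.exists_refine r r'
    refine ⟨⟨n, t, hpos, hmono, hlast, fun x => r.f (fun i => x (τ i)) + r'.f (fun i => x (τ' i)),
      ?_⟩, ?_⟩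
    · have hl : ∀ {m : ℕ} (ρ : Fin m → Fin (n + 1)), Function.HasTemperateGrowth
          (fun (x : Fin (n + 1) → Euc d) (i : Fin m) => x (ρ i)) := fun ρ =>
        (ContinuousLinearMap.pi fun i =>
          ContinuousLinearMap.proj (R := ℝ) (φ := fun _ => Euc d) (ρ i)).hasTemperateGrowth
      exact (r.f_growth.comp (hl τ)).add (r'.f_growth.comp (hl τ'))
    · funext γ
      simp only [Cyl.toFun, Pi.add_apply]
      congr 2 <;> funext i <;> simp [Cyl.ev, h, h']
  smul_mem' := by
    rintro c _ ⟨r, rfl⟩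
    refine ⟨⟨r.n, r.s, r.s_pos, r.s_strictMono, r.s_last, fun x => c * r.f x, ?_⟩, rfl⟩
    exact (Function.HasTemperateGrowth.const c).mul r.f_growth

open Classical in
/-- The gradient `DF(γ) : [0,1] → ℝᵈ` of `F ∈ Z`, computed from any presentation of `F`. -/
def malliavinGrad {d : ℕ} (F : Path d → ℝ) (γ : Path d) : I → Euc d :=
  if h : ∃ r : Cyl d, r.toFun = F then h.choose.grad γ else 0

theorem malliavinGrad_toFun {d : ℕ} (r : Cyl d) (γ : Path d) :
    malliavinGrad r.toFun γ = r.grad γ := by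
  have h : ∃ r' : Cyl d, r'.toFun = r.toFun := ⟨r, rfl⟩
  rw [malliavinGrad, dif_pos h, Cyl.grad_eq_of_toFun_eq h.choose_spec]

/-- The measure `φ ν`. -/
def weighted {d : ℕ} (ν : Measure (Path d)) (φ : Path d → ℝ) : Measure (Path d) :=
  ν.withDensity (fun γ => ENNReal.ofReal (φ γ))

/-- The gradient form `𝒟(F, G) = ½ ∫ ⟨DF, DG⟩ φ dν`. -/
def gradForm {d : ℕ} (ν : Measure (Path d)) (φ : Path d → ℝ) (F G : Path d → ℝ) : ℝ :=
  (1 / 2) * ∫ γ, cmInner (malliavinGrad F γ) (malliavinGrad G γ) * φ γ ∂ν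

/-- Convergence of `u n` to `v` in `L²(μ)`. -/
def TendstoL2 {Ω : Type*} [MeasurableSpace Ω] (μ : Measure Ω) (u : ℕ → Ω → ℝ) (v : Ω → ℝ) :
    Prop :=
  Tendsto (fun n => eLpNorm (u n - v) 2 μ) atTop (𝓝 0)

/-- The sequence `u` is Cauchy with respect to the form `E`. -/
def FormCauchy {Ω : Type*} (E : (Ω → ℝ) → (Ω → ℝ) → ℝ) (u : ℕ → Ω → ℝ) : Prop :=
  Tendsto (fun p : ℕ × ℕ => E (u p.1 - u p.2) (u p.1 - u p.2)) atTop (𝓝 0)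

/-- The form `E` with domain `D` is closable on `L²(μ)`. -/
def IsClosable {Ω : Type*} [MeasurableSpace Ω] (μ : Measure Ω) (D : Submodule ℝ (Ω → ℝ))
    (E : (Ω → ℝ) → (Ω → ℝ) → ℝ) : Prop :=
  ∀ u : ℕ → Ω → ℝ, (∀ n, u n ∈ D) → TendstoL2 μ u 0 → FormCauchy E u →
    Tendsto (fun n => E (u n) (u n)) atTop (𝓝 0)

/-- The function `u` belongs to the domain of the generator of the closure of `(E, D)` on
`L²(μ)`, and the generator maps `u` to `w`: `u` is in the domain of the closure `Ē`, and
`Ē(u, v) = -∫ w v dμ` for all `v` in the form core `D`. -/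
def IsGenerator {Ω : Type*} [MeasurableSpace Ω] (μ : Measure Ω) (D : Submodule ℝ (Ω → ℝ))
    (E : (Ω → ℝ) → (Ω → ℝ) → ℝ) (u w : Ω → ℝ) : Prop :=
  MemLp u 2 μ ∧ MemLp w 2 μ ∧
    ∃ un : ℕ → Ω → ℝ, (∀ n, un n ∈ D) ∧ TendstoL2 μ un u ∧ FormCauchy E un ∧
      ∀ v ∈ D, Tendsto (fun n => E (un n) v) atTop (𝓝 (-∫ x, w x * v x ∂μ))

end WienerForm

end

/-! Write `∂` for the derivative of `F` in the direction `u ↦ (u ∧ t) v`. This direction represents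
evaluation, `h ↦ ⟨h(t), v⟩`, in the Cameron–Martin space, so for cylindrical `F` the product `⟨DF,
DG⟩` is a finite sum of derivatives `∂G` with coefficients in `Z` (`cmInner_malliavinGrad_eq_sum`).
Under `ν` the adjoint of `∂` is explicit: `∫ ∂F · G dν = ∫ F (G ⟨γ(t), v⟩ - ∂G) dν`
(`integral_gradIn_mul`). This is Stein's identity for the Gaussian finite-dimensional laws, itself
obtained by differentiating the rotation invariance of `μ ⊗ μ`.

Closability. Let `uₙ → 0` in `L²(φν)` be Cauchy for the form. The form dominates `|∂F|²`, so `∂uₙ`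
is bounded in `L²(φν)`. Testing against `G / φ` with `G ∈ Z` cancels the weight, and integration by
parts turns the pairing into that of `uₙ` with some `K / φ`, `K ∈ Z`, which tends to `0`. Here `G /
φ ∈ L²(φν)` because `G² / φ ∈ L¹(ν)`. Such functions are total, since `Z` contains the sines and
cosines of linear functionals of finitely many path values. Hence `∂uₙ → 0` weakly, so `𝒟(uₙ, uₘ) →
0` as `n → ∞` with `m` fixed, and expanding `𝒟(uₙ - uₘ, uₙ - uₘ)` makes `𝒟(uₘ, uₘ)` small.

Generator. With `φ = 1` the same integration by parts, summed over times and coordinates, gives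
`𝒟(F, v) = -∫ LF · v dν`, and `LF` is again in `Z ⊂ L²(ν)`. -/

noncomputable section

namespace WienerForm

variable {d : ℕ}

/-! ### Cylindrical functions over arbitrary finite families of times -/

/-- A temperate function of the values of the path at finitely many times belongs to `Z`; the
times need be neither ordered, nor distinct, nor positive. -/
theorem mem_Z_of_finite {ι : Type*} [Fintype ι] (τ : ι → I) {g : (ι → Euc d) → ℝ}
    (hg : g.HasTemperateGrowth) : (fun γ : Path d => g fun i => γ (τ i)) ∈ Z d := by
  classical
  -- A presentation needs positive times ending at `1`, so `1` is adjoined and the time `0` is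
  -- discarded.
  set T : Finset I := insert 1 ((Finset.univ.image τ).filter (0 < ·)) with hT
  obtain ⟨n, hn⟩ : ∃ n, T.card = n + 1 :=
    Nat.exists_eq_succ_of_ne_zero (Finset.card_ne_zero_of_mem (Finset.mem_insert_self _ _))
  have hr : ∀ x ∈ T, ∃ i, T.orderEmbOfFin hn i = x := by
    intro x hx
    have : x ∈ Set.range (T.orderEmbOfFin hn) := by
      rw [Finset.range_orderEmbOfFin]; exact hx
    exact this
  have hτ : ∀ i, ∃ A : (Fin (n + 1) → Euc d) →L[ℝ] Euc d, ∀ γ : Path d,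
      A (fun j => γ (T.orderEmbOfFin hn j)) = γ (τ i) := by
    intro i
    rcases eq_or_lt_of_le (show 0 ≤ τ i from (τ i).2.1) with h | h
    -- Paths vanish at time `0`, so the zero map recovers that value.
    · exact ⟨0, fun γ => by rw [← h]; exact γ.2.symm⟩
    · obtain ⟨j, hj⟩ := hr (τ i) (by simp [hT, h])
      exact ⟨ContinuousLinearMap.proj (R := ℝ) (φ := fun _ => Euc d) j, fun γ => by simp [hj]⟩
  choose A hA using hτ
  refine ⟨⟨n, T.orderEmbOfFin hn, fun i => ?_, (T.orderEmbOfFin hn).strictMono, ?_,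
    fun x => g fun i => A i x, hg.comp (ContinuousLinearMap.pi A).hasTemperateGrowth⟩, ?_⟩
  · have hi := T.orderEmbOfFin_mem hn i
    generalize T.orderEmbOfFin hn i = x at hi ⊢
    rw [hT, Finset.mem_insert, Finset.mem_filter] at hi
    rcases hi with rfl | ⟨-, h⟩
    · exact zero_lt_one
    · exact h
  · obtain ⟨i, hi⟩ := hr 1 (Finset.mem_insert_self _ _)
    refine le_antisymm (Subtype.coe_le_coe.1 (T.orderEmbOfFin hn _).2.2) ?_
    rw [← hi]
    exact (T.orderEmbOfFin hn).monotone (Fin.le_last i)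
  · funext γ
    change g (fun i => A i fun j => γ (T.orderEmbOfFin hn j)) = _
    simp only [hA]

theorem const_mem_Z (c : ℝ) : (fun _ : Path d => c) ∈ Z d :=
  mem_Z_of_finite (ι := Empty) (fun _ => 0) (Function.HasTemperateGrowth.const c)

theorem inner_eval_mem_Z (t : I) (v : Euc d) : (fun γ : Path d => inner ℝ (γ t) v) ∈ Z d :=
  mem_Z_of_finite (ι := Unit) (fun _ => t) (g := fun x => inner ℝ (x ()) v)
    (((innerSL ℝ).flip v).comp
      (ContinuousLinearMap.proj (R := ℝ) (φ := fun _ : Unit => Euc d) ())).hasTemperateGrowth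

theorem mul_mem_Z {F G : Path d → ℝ} (hF : F ∈ Z d) (hG : G ∈ Z d) :
    (fun γ => F γ * G γ) ∈ Z d := by
  obtain ⟨r, rfl⟩ := hF
  obtain ⟨q, rfl⟩ := hG
  have hl : (fun x : Fin (r.n + 1) ⊕ Fin (q.n + 1) → Euc d =>
      (fun i => x (Sum.inl i))).HasTemperateGrowth :=
    (ContinuousLinearMap.pi fun i => ContinuousLinearMap.proj (R := ℝ)
      (φ := fun _ : Fin (r.n + 1) ⊕ Fin (q.n + 1) => Euc d) (Sum.inl i)).hasTemperateGrowth
  have hr : (fun x : Fin (r.n + 1) ⊕ Fin (q.n + 1) → Euc d =>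
      (fun i => x (Sum.inr i))).HasTemperateGrowth :=
    (ContinuousLinearMap.pi fun i => ContinuousLinearMap.proj (R := ℝ)
      (φ := fun _ : Fin (r.n + 1) ⊕ Fin (q.n + 1) => Euc d) (Sum.inr i)).hasTemperateGrowth
  exact mem_Z_of_finite (Sum.elim r.s q.s) ((r.f_growth.comp hl).mul (q.f_growth.comp hr))

theorem sum_mem_Z {ι : Type*} (s : Finset ι) {F : ι → Path d → ℝ} (hF : ∀ i ∈ s, F i ∈ Z d) :
    (fun γ => ∑ i ∈ s, F i γ) ∈ Z d := by
  have h := (Z d).sum_mem hF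
  rwa [show ∑ i ∈ s, F i = fun γ => ∑ i ∈ s, F i γ by funext γ; simp] at h

theorem measurable_eval (t : I) : Measurable (fun γ : Path d => γ t) :=
  Measurable.of_comap_le (le_iSup (fun t : I =>
    MeasurableSpace.comap (fun γ : Path d => γ t) inferInstance) t)

theorem measurable_of_mem_Z {F : Path d → ℝ} (hF : F ∈ Z d) : Measurable F := by
  obtain ⟨r, rfl⟩ := hF
  exact r.f_growth.1.continuous.measurable.comp
    (measurable_pi_lambda _ fun i => measurable_eval (r.s i))

/-! ### The directional derivatives `⟨D_t F, v⟩` -/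

/-- The derivative `⟨D_t F(γ), v⟩` of `F` at `γ` in the direction `u ↦ (u ∧ t) v`. -/
def gradIn (t : I) (v : Euc d) (F : Path d → ℝ) (γ : Path d) : ℝ :=
  inner ℝ (malliavinGrad F γ t) v

/-- This characterises the gradient without reference to a presentation. The product, difference and
reindexing rules below all follow from it by uniqueness of derivatives. -/
theorem hasDerivAt_shift_of_mem_Z {F : Path d → ℝ} (hF : F ∈ Z d) (γ : Path d) (t : I)
    (v : Euc d) : HasDerivAt (fun ε => F (Cyl.shift γ t v ε)) (gradIn t v F γ) 0 := by
  obtain ⟨r, rfl⟩ := hF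
  rw [gradIn, malliavinGrad_toFun]
  exact r.hasDerivAt_shift γ t v

theorem shift_zero (γ : Path d) (t : I) (v : Euc d) : Cyl.shift γ t v 0 = γ := by
  apply Subtype.ext
  exact (congrArg (γ.1 + ·) (zero_smul ℝ (Cyl.ramp t v))).trans (add_zero γ.1)

theorem gradIn_of_finite {ι : Type*} [Fintype ι] (τ : ι → I) {g : (ι → Euc d) → ℝ}
    (hg : g.HasTemperateGrowth) (t : I) (v : Euc d) (γ : Path d) :
    gradIn t v (fun γ : Path d => g fun i => γ (τ i)) γ =
      fderiv ℝ g (fun i => γ (τ i)) (fun i => min (τ i : ℝ) (t : ℝ) • v) := by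
  refine (hasDerivAt_shift_of_mem_Z (mem_Z_of_finite τ hg) γ t v).unique ?_
  have hf : HasFDerivAt g (fderiv ℝ g (fun i => γ (τ i)))
      ((fun i => γ (τ i)) + (0 : ℝ) • (fun i => min (τ i : ℝ) (t : ℝ) • v)) := by
    rw [zero_smul, add_zero]
    exact (hg.1.differentiable (by simp)).differentiableAt.hasFDerivAt
  have hl : HasDerivAt
      (fun ε : ℝ => (fun i => γ (τ i)) + ε • (fun i => min (τ i : ℝ) (t : ℝ) • v))
      (fun i => min (τ i : ℝ) (t : ℝ) • v) 0 := by
    simpa using ((hasDerivAt_id (0 : ℝ)).smul_const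
      (fun i => min (τ i : ℝ) (t : ℝ) • v)).const_add (fun i => γ (τ i))
  exact hf.comp_hasDerivAt (0 : ℝ) hl

theorem _root_.Function.HasTemperateGrowth.fderiv {E : Type*} [NormedAddCommGroup E]
    [NormedSpace ℝ E] {g : E → ℝ} (hg : g.HasTemperateGrowth) :
    (fderiv ℝ g).HasTemperateGrowth := by
  refine ⟨hg.1.fderiv_right (by simp), fun n => ?_⟩
  obtain ⟨k, C, h⟩ := hg.2 (n + 1)
  exact ⟨k, C, fun x => by rw [norm_iteratedFDeriv_fderiv]; exact h x⟩

theorem _root_.Function.HasTemperateGrowth.fderiv_apply {E : Type*} [NormedAddCommGroup E]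
    [NormedSpace ℝ E] {g : E → ℝ} (hg : g.HasTemperateGrowth) (w : E) :
    (fun x => _root_.fderiv ℝ g x w).HasTemperateGrowth :=
  (ContinuousLinearMap.apply ℝ ℝ w).hasTemperateGrowth.comp hg.fderiv

theorem gradIn_mem_Z {F : Path d → ℝ} (hF : F ∈ Z d) (t : I) (v : Euc d) :
    gradIn t v F ∈ Z d := by
  obtain ⟨r, rfl⟩ := hF
  have h : gradIn t v r.toFun = fun γ =>
      fderiv ℝ r.f (fun i => γ (r.s i)) (fun i => min (r.s i : ℝ) (t : ℝ) • v) :=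
    funext fun γ => gradIn_of_finite r.s r.f_growth t v γ
  rw [h]
  exact mem_Z_of_finite r.s (r.f_growth.fderiv_apply _)

theorem gradIn_mul {F G : Path d → ℝ} (hF : F ∈ Z d) (hG : G ∈ Z d) (t : I) (v : Euc d)
    (γ : Path d) : gradIn t v (fun γ => F γ * G γ) γ =
      gradIn t v F γ * G γ + F γ * gradIn t v G γ := by
  have h := (hasDerivAt_shift_of_mem_Z hF γ t v).mul (hasDerivAt_shift_of_mem_Z hG γ t v)
  rw [shift_zero] at h
  exact (hasDerivAt_shift_of_mem_Z (mul_mem_Z hF hG) γ t v).unique h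

theorem malliavinGrad_sub {F G : Path d → ℝ} (hF : F ∈ Z d) (hG : G ∈ Z d) (γ : Path d)
    (t : I) : malliavinGrad (F - G) γ t = malliavinGrad F γ t - malliavinGrad G γ t := by
  refine ext_inner_right ℝ fun v => ?_
  rw [inner_sub_left]
  exact (hasDerivAt_shift_of_mem_Z ((Z d).sub_mem hF hG) γ t v).unique
    ((hasDerivAt_shift_of_mem_Z hF γ t v).sub (hasDerivAt_shift_of_mem_Z hG γ t v))

theorem gradIn_sub {F G : Path d → ℝ} (hF : F ∈ Z d) (hG : G ∈ Z d) (t : I) (v : Euc d) :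
    gradIn t v (F - G) = gradIn t v F - gradIn t v G := by
  funext γ
  simp only [gradIn, Pi.sub_apply, malliavinGrad_sub hF hG, inner_sub_left]

/-! ### The Cameron–Martin inner product of gradients -/

/-- The piecewise linear path `t ↦ ∑ᵢ (τᵢ ∧ t) vᵢ`. -/
def rampSum {ι : Type*} [Fintype ι] (τ : ι → I) (v : ι → Euc d) (t : I) : Euc d :=
  ∑ i, min (τ i : ℝ) (t : ℝ) • v i

theorem deriv_IccExtend_rampSum {ι : Type*} [Fintype ι] (τ : ι → I) (v : ι → Euc d) {x : ℝ}
    (hx : x ∈ Set.Ioo (0 : ℝ) 1) (hτ : ∀ i, x ≠ τ i) :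
    deriv (Set.IccExtend zero_le_one (rampSum τ v)) x =
      ∑ i, (Set.Iio (τ i : ℝ)).indicator (fun _ => v i) x := by
  have h : HasDerivAt (fun y : ℝ => ∑ i, min (τ i : ℝ) y • v i)
      (∑ i, (Set.Iio (τ i : ℝ)).indicator (fun _ => v i) x) x := by
    refine HasDerivAt.fun_sum fun i _ => ?_
    rcases lt_or_gt_of_ne (hτ i) with hi | hi
    · rw [Set.indicator_of_mem (Set.mem_Iio.2 hi)]
      have h1 : HasDerivAt (fun y : ℝ => y • v i) (v i) x := by
        simpa using (hasDerivAt_id x).smul_const (v i)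
      refine h1.congr_of_eventuallyEq ?_
      filter_upwards [Iio_mem_nhds hi] with y hy
      rw [min_eq_right (le_of_lt hy)]
    · rw [Set.indicator_of_notMem (by simpa using hi.le)]
      refine (hasDerivAt_const x ((τ i : ℝ) • v i)).congr_of_eventuallyEq ?_
      filter_upwards [Ioi_mem_nhds hi] with y hy
      rw [min_eq_left (le_of_lt hy)]
  refine (h.congr_of_eventuallyEq ?_).deriv
  filter_upwards [Ioo_mem_nhds hx.1 hx.2] with y hy
  rw [Set.IccExtend_of_mem _ _ (Set.Ioo_subset_Icc_self hy), rampSum]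

theorem intervalIntegral_indicator_Iio_mul (s t : I) (c : ℝ) :
    ∫ x in (0 : ℝ)..1, (Set.Iio (s : ℝ) ∩ Set.Iio (t : ℝ)).indicator (fun _ => c) x =
      min (s : ℝ) (t : ℝ) * c := by
  have h0 : (0 : ℝ) ≤ min (s : ℝ) (t : ℝ) := le_min s.2.1 t.2.1
  have h1 : min (s : ℝ) (t : ℝ) ≤ 1 := min_le_of_left_le s.2.2
  rw [intervalIntegral.integral_of_le zero_le_one, Set.Iio_inter_Iio,
    setIntegral_indicator measurableSet_Iio, setIntegral_const]
  have h : Set.Ioc (0 : ℝ) 1 ∩ Set.Iio (min (s : ℝ) (t : ℝ)) =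
      Set.Ioo 0 (min (s : ℝ) (t : ℝ)) := by
    ext x
    exact ⟨fun h => ⟨h.1.1, h.2⟩, fun h => ⟨⟨h.1, h.2.le.trans h1⟩, h.2⟩⟩
  rw [h, Real.volume_real_Ioo_of_le h0, sub_zero, smul_eq_mul]

theorem cmInner_rampSum {ι κ : Type*} [Fintype ι] [Fintype κ] (τ : ι → I) (v : ι → Euc d)
    (ρ : κ → I) (w : κ → Euc d) : cmInner (rampSum τ v) (rampSum ρ w) =
      ∑ i, ∑ j, min (τ i : ℝ) (ρ j : ℝ) * inner ℝ (v i) (w j) := by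
  have hae : ∀ᵐ x : ℝ ∂volume, x ∈ Set.uIoc (0 : ℝ) 1 →
      inner ℝ (deriv (Set.IccExtend zero_le_one (rampSum τ v)) x)
        (deriv (Set.IccExtend zero_le_one (rampSum ρ w)) x) =
      ∑ i, ∑ j, (Set.Iio (τ i : ℝ) ∩ Set.Iio (ρ j : ℝ)).indicator
        (fun _ => inner ℝ (v i) (w j)) x := by
    -- The piecewise linear paths are differentiated away from their break points and the endpoint
    -- `1`, a finite and hence null set.
    have hfin : (insert (1 : ℝ) (Set.range (fun i => (τ i : ℝ)) ∪
        Set.range (fun j => (ρ j : ℝ)))).Finite :=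
      ((Set.finite_range _).union (Set.finite_range _)).insert _
    filter_upwards [hfin.countable.ae_notMem volume] with x hx hx'
    rw [Set.uIoc_of_le zero_le_one] at hx'
    simp only [Set.mem_insert_iff, Set.mem_union, Set.mem_range, not_or, not_exists] at hx
    have hx1 : x ∈ Set.Ioo (0 : ℝ) 1 := ⟨hx'.1, lt_of_le_of_ne hx'.2 hx.1⟩
    rw [deriv_IccExtend_rampSum τ v hx1 fun i h => hx.2.1 i h.symm,
      deriv_IccExtend_rampSum ρ w hx1 fun i h => hx.2.2 i h.symm, sum_inner]
    refine Finset.sum_congr rfl fun i _ => ?_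
    rw [inner_sum]
    refine Finset.sum_congr rfl fun j _ => ?_
    by_cases h1 : x < τ i <;> by_cases h2 : x < ρ j <;> simp [Set.indicator, h1, h2]
  have hint : ∀ (s t : I) (c : ℝ), IntervalIntegrable
      ((Set.Iio (s : ℝ) ∩ Set.Iio (t : ℝ)).indicator (fun _ => c)) volume 0 1 := by
    intro s t c
    rw [intervalIntegrable_iff_integrableOn_Ioc_of_le zero_le_one]
    exact (integrable_const c).indicator (measurableSet_Iio.inter measurableSet_Iio)
  rw [cmInner, intervalIntegral.integral_congr_ae hae,
    intervalIntegral.integral_finsetSum fun i _ => ?_]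
  · refine Finset.sum_congr rfl fun i _ => ?_
    rw [intervalIntegral.integral_finsetSum fun j _ => hint _ _ _]
    exact Finset.sum_congr rfl fun j _ => intervalIntegral_indicator_Iio_mul _ _ _
  · simpa only [Finset.sum_fn] using IntervalIntegrable.sum Finset.univ
      fun j _ => hint (τ i) (ρ j) (inner ℝ (v i) (w j))

/-- Reproducing property: `u ↦ (u ∧ t) v` is the Riesz representer of `h ↦ ⟨h(t), v⟩`, and both
sides are linear in the weights `v i`. -/
theorem cmInner_rampSum_left {ι κ : Type*} [Fintype ι] [Fintype κ] (τ : ι → I)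
    (v : ι → Euc d) (ρ : κ → I) (w : κ → Euc d) :
    cmInner (rampSum τ v) (rampSum ρ w) = ∑ i, inner ℝ (rampSum ρ w (τ i)) (v i) := by
  rw [cmInner_rampSum]
  refine Finset.sum_congr rfl fun i _ => ?_
  rw [rampSum, sum_inner]
  refine Finset.sum_congr rfl fun j _ => ?_
  rw [inner_smul_left, real_inner_comm, min_comm]
  rfl

theorem cmInner_self_nonneg (h : I → Euc d) : 0 ≤ cmInner h h :=
  intervalIntegral.integral_nonneg zero_le_one fun _ _ => real_inner_self_nonneg

/-- With `h = rampSum τ v` and `c = ⟨h(t), e⟩`, expanding `‖h - c (· ∧ t) e‖² ≥ 0` gives `‖h‖² - 2c²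
+ t c² ≥ 0`, and `t ≤ 1`. -/
theorem sq_inner_rampSum_le {ι : Type*} [Fintype ι] (τ : ι → I) (v : ι → Euc d) (t : I)
    {e : Euc d} (he : ‖e‖ = 1) :
    inner ℝ (rampSum τ v t) e ^ 2 ≤ cmInner (rampSum τ v) (rampSum τ v) := by
  set c : ℝ := inner ℝ (rampSum τ v t) e with hc
  -- The extra index `none` carries the subtracted ramp, so the difference is again a `rampSum`.
  have h := cmInner_self_nonneg
    (rampSum (fun o : Option ι => o.elim t τ) (fun o : Option ι => o.elim (-(c • e)) v))
  have hs : ∀ u, rampSum (fun o : Option ι => o.elim t τ)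
      (fun o : Option ι => o.elim (-(c • e)) v) u = rampSum τ v u - (min (t : ℝ) u * c) • e := by
    intro u
    simp only [rampSum, Fintype.sum_option, Option.elim, smul_neg, smul_smul]
    abel
  have hq := cmInner_rampSum_left τ v τ v
  have hc' : ∑ i, min (τ i : ℝ) (t : ℝ) * inner ℝ (v i) e = c := by
    rw [hc, rampSum, sum_inner]
    exact Finset.sum_congr rfl fun i _ => by rw [inner_smul_left, conj_trivial]
  have h2 : ∑ i, min (t : ℝ) (τ i : ℝ) * c * inner ℝ e (v i) = c * c := by
    conv_rhs => rw [← hc', Finset.mul_sum, hc']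
    refine Finset.sum_congr rfl fun i _ => ?_
    rw [real_inner_comm, min_comm]
    ring
  rw [cmInner_rampSum_left, Fintype.sum_option] at h
  simp only [hs, Option.elim_none, Option.elim_some, inner_sub_left, inner_neg_right, inner_smul_right,
    inner_smul_left, Finset.sum_sub_distrib, real_inner_self_eq_norm_sq,
    he, ← hc, min_self, conj_trivial, h2, ← hq] at h
  have ht := t.2.2
  nlinarith [mul_nonneg (sub_nonneg.2 ht) (mul_self_nonneg c)]

theorem cmInner_malliavinGrad (r : Cyl d) {G : Path d → ℝ} (hG : G ∈ Z d) (γ : Path d) :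
    cmInner (malliavinGrad r.toFun γ) (malliavinGrad G γ) =
      ∑ i, inner ℝ (malliavinGrad G γ (r.s i)) (r.partialGrad i (r.ev γ)) := by
  obtain ⟨q, rfl⟩ := hG
  rw [show malliavinGrad r.toFun γ = rampSum r.s fun i => r.partialGrad i (r.ev γ) from
      funext fun t => by rw [malliavinGrad_toFun]; rfl,
    show malliavinGrad q.toFun γ = rampSum q.s fun i => q.partialGrad i (q.ev γ) from
      funext fun t => by rw [malliavinGrad_toFun]; rfl, cmInner_rampSum_left]

/-- The unit coordinate vectors of `ℝᵈ`. -/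
abbrev unitVec (a : Fin d) : Euc d := EuclideanSpace.single a 1

/-- The partial derivative `∂_{i,a} f` along the path, as a function on path space. -/
def Cyl.coordDeriv (r : Cyl d) (i : Fin (r.n + 1)) (a : Fin d) (γ : Path d) : ℝ :=
  fderiv ℝ r.f (r.ev γ) (Pi.single i (unitVec a))

theorem Cyl.coordDeriv_mem_Z (r : Cyl d) (i : Fin (r.n + 1)) (a : Fin d) :
    r.coordDeriv i a ∈ Z d :=
  mem_Z_of_finite r.s (r.f_growth.fderiv_apply _)

theorem inner_eq_sum_unitVec (x y : Euc d) :
    inner ℝ x y = ∑ a, inner ℝ x (unitVec a) * inner ℝ y (unitVec a) := by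
  simp [PiLp.inner_apply, mul_comm]

/-- Reduces the form to finitely many directional derivatives of `G` with coefficients in `Z`; weak
convergence and integration by parts are then applied term by term. -/
theorem cmInner_malliavinGrad_eq_sum (r : Cyl d) {G : Path d → ℝ} (hG : G ∈ Z d) (γ : Path d) :
    cmInner (malliavinGrad r.toFun γ) (malliavinGrad G γ) =
      ∑ i, ∑ a, gradIn (r.s i) (unitVec a) G γ * r.coordDeriv i a γ := by
  rw [cmInner_malliavinGrad r hG]
  refine Finset.sum_congr rfl fun i _ => ?_
  rw [inner_eq_sum_unitVec]
  refine Finset.sum_congr rfl fun a _ => ?_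
  rw [r.inner_partialGrad, gradIn, Cyl.coordDeriv]

theorem sq_gradIn_le {F : Path d → ℝ} (hF : F ∈ Z d) (t : I) (a : Fin d) (γ : Path d) :
    gradIn t (unitVec a) F γ ^ 2 ≤ cmInner (malliavinGrad F γ) (malliavinGrad F γ) := by
  obtain ⟨r, rfl⟩ := hF
  rw [gradIn, show malliavinGrad r.toFun γ = rampSum r.s fun i => r.partialGrad i (r.ev γ) from
    funext fun t => by rw [malliavinGrad_toFun]; rfl]
  exact sq_inner_rampSum_le _ _ _ (by simp)

theorem cmInner_malliavinGrad_mem_Z {F G : Path d → ℝ} (hF : F ∈ Z d) (hG : G ∈ Z d) :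
    (fun γ => cmInner (malliavinGrad F γ) (malliavinGrad G γ)) ∈ Z d := by
  obtain ⟨r, rfl⟩ := hF
  simp only [cmInner_malliavinGrad_eq_sum r hG]
  exact sum_mem_Z _ fun i _ => sum_mem_Z _ fun a _ =>
    mul_mem_Z (gradIn_mem_Z hG _ _) (r.coordDeriv_mem_Z i a)

theorem cmInner_comm (h k : I → Euc d) : cmInner h k = cmInner k h := by
  simp only [cmInner, real_inner_comm]

/-- `cmInner` is not additive on arbitrary functions, where `deriv` may take its default value. On
gradients, linearity in the second slot comes from the reproducing formula, which only evaluates the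
gradient at finitely many times. -/
theorem cmInner_malliavinGrad_sub {F G : Path d → ℝ} (hF : F ∈ Z d) (hG : G ∈ Z d)
    (γ : Path d) :
    cmInner (malliavinGrad (F - G) γ) (malliavinGrad (F - G) γ) =
      cmInner (malliavinGrad F γ) (malliavinGrad F γ)
        - 2 * cmInner (malliavinGrad F γ) (malliavinGrad G γ)
        + cmInner (malliavinGrad G γ) (malliavinGrad G γ) := by
  have key : ∀ H ∈ Z d, cmInner (malliavinGrad H γ) (malliavinGrad (F - G) γ) =
      cmInner (malliavinGrad H γ) (malliavinGrad F γ)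
        - cmInner (malliavinGrad H γ) (malliavinGrad G γ) := by
    rintro _ ⟨r, rfl⟩
    rw [cmInner_malliavinGrad r ((Z d).sub_mem hF hG), cmInner_malliavinGrad r hF,
      cmInner_malliavinGrad r hG, ← Finset.sum_sub_distrib]
    exact Finset.sum_congr rfl fun i _ => by rw [malliavinGrad_sub hF hG, inner_sub_left]
  rw [key _ ((Z d).sub_mem hF hG), cmInner_comm (malliavinGrad (F - G) γ) (malliavinGrad F γ),
    key F hF, cmInner_comm (malliavinGrad (F - G) γ) (malliavinGrad G γ), key G hG,
    cmInner_comm (malliavinGrad G γ) (malliavinGrad F γ)]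
  ring

end WienerForm

/-! ### Gaussian integration by parts -/

namespace ProbabilityTheory.IsGaussian

variable {E : Type*} [NormedAddCommGroup E] [NormedSpace ℝ E] [MeasurableSpace E] [BorelSpace E]
  [SecondCountableTopology E] [CompleteSpace E]

/-- Gaussian measures have moments of every order; these powers dominate all temperate functions. -/
theorem integrable_one_add_norm_pow (μ : Measure E) [IsGaussian μ] (k : ℕ) :
    Integrable (fun x => (1 + ‖x‖) ^ k) μ := by
  rcases Nat.eq_zero_or_pos k with rfl | hk
  · simp
  have h1 : MemLp (fun x : E => ‖x‖) (k : ENNReal) μ :=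
    (memLp_id μ (k : ENNReal) (ENNReal.natCast_ne_top k)).norm
  have h2 : MemLp (fun x : E => 1 + ‖x‖) (k : ENNReal) μ := (memLp_const (1 : ℝ)).add h1
  refine (h2.integrable_norm_pow hk.ne').congr (ae_of_all _ fun x => ?_)
  have h3 : ‖(1 + ‖x‖ : ℝ)‖ = 1 + ‖x‖ := Real.norm_of_nonneg (by positivity)
  exact congrArg (· ^ k) h3

theorem integrable_of_hasTemperateGrowth (μ : Measure E) [IsGaussian μ] {f : E → ℝ}
    (hf : f.HasTemperateGrowth) : Integrable f μ := by
  obtain ⟨k, C, h⟩ := hf.2 0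
  refine ((integrable_one_add_norm_pow μ k).const_mul C).mono'
    hf.1.continuous.aestronglyMeasurable (ae_of_all _ fun x => ?_)
  simpa using h x

/-- The derivative of `θ ↦ 𝔼[f(X cos θ + Y sin θ) L(Y)]` at `0`. -/
theorem hasDerivAt_integral_rotation (μ : Measure E) [IsGaussian μ] {f : E → ℝ}
    (hf : f.HasTemperateGrowth) (L : StrongDual ℝ E) :
    HasDerivAt (fun θ : ℝ => ∫ p : E × E, f (Real.cos θ • p.1 + Real.sin θ • p.2) * L p.2
      ∂(μ.prod μ)) (∫ p : E × E, fderiv ℝ f p.1 p.2 * L p.2 ∂(μ.prod μ)) 0 := by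
  obtain ⟨k, C, hC0, hC⟩ := hf.norm_iteratedFDeriv_le_uniform 1
  have hCf : ∀ x, ‖f x‖ ≤ C * (1 + ‖x‖) ^ k := fun x => by simpa using hC 0 (by simp) x
  have hCd : ∀ x, ‖fderiv ℝ f x‖ ≤ C * (1 + ‖x‖) ^ k := fun x => by
    simpa [norm_iteratedFDeriv_one] using hC 1 le_rfl x
  have hfc := hf.1.continuous
  have hdc : Continuous (fderiv ℝ f) := hf.1.continuous_fderiv (by simp)
  have hrot : ∀ (a b : ℝ) (p : E × E), |a| ≤ 1 → |b| ≤ 1 →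
      ‖a • p.1 + b • p.2‖ ≤ 2 * (1 + ‖p‖) := by
    intro a b p ha hb
    have h1 : ‖a • p.1‖ ≤ ‖p‖ := by
      rw [norm_smul, Real.norm_eq_abs]
      exact (mul_le_of_le_one_left (norm_nonneg _) ha).trans (norm_fst_le p)
    have h2 : ‖b • p.2‖ ≤ ‖p‖ := by
      rw [norm_smul, Real.norm_eq_abs]
      exact (mul_le_of_le_one_left (norm_nonneg _) hb).trans (norm_snd_le p)
    linarith [norm_add_le (a • p.1) (b • p.2)]
  have hL : ∀ p : E × E, ‖L p.2‖ ≤ ‖L‖ * (1 + ‖p‖) := fun p =>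
    (L.le_opNorm _).trans (by gcongr; linarith [norm_snd_le p])
  have hz : ∀ (θ : ℝ) (p : E × E),
      (1 + ‖Real.cos θ • p.1 + Real.sin θ • p.2‖) ^ k ≤ (3 * (1 + ‖p‖)) ^ k := by
    intro θ p
    gcongr
    linarith [hrot _ _ p (Real.abs_cos_le_one θ) (Real.abs_sin_le_one θ), norm_nonneg p]
  -- In the bound, `3 (1 + ‖p‖)` controls `1 +` the norm of the rotated point, `2 (1 + ‖p‖)` its
  -- velocity in `θ`, and `‖L‖ (1 + ‖p‖)` the factor `L p.2`.
  have key := hasDerivAt_integral_of_dominated_loc_of_deriv_le (μ := μ.prod μ) (x₀ := (0 : ℝ))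
    (s := Set.univ)
    (F := fun θ (p : E × E) => f (Real.cos θ • p.1 + Real.sin θ • p.2) * L p.2)
    (F' := fun θ (p : E × E) => fderiv ℝ f (Real.cos θ • p.1 + Real.sin θ • p.2)
      (-Real.sin θ • p.1 + Real.cos θ • p.2) * L p.2)
    (bound := fun p => C * (3 * (1 + ‖p‖)) ^ k * (2 * (1 + ‖p‖)) * (‖L‖ * (1 + ‖p‖)))
    univ_mem (.of_forall fun θ => Continuous.aestronglyMeasurable (by fun_prop)) ?_
    (Continuous.aestronglyMeasurable (by fun_prop)) ?_ ?_ ?_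
  · simpa using key.2
  · refine ((integrable_one_add_norm_pow (μ.prod μ) (k + 1)).const_mul
      (C * 3 ^ k * ‖L‖)).mono' (Continuous.aestronglyMeasurable (by fun_prop))
      (ae_of_all _ fun p => ?_)
    rw [norm_mul]
    refine (mul_le_mul ((hCf _).trans (mul_le_mul_of_nonneg_left (hz 0 p) hC0)) (hL p)
      (norm_nonneg _) (by positivity)).trans (le_of_eq ?_)
    rw [mul_pow, pow_succ]
    ring
  · refine ae_of_all _ fun p θ _ => ?_
    rw [norm_mul]
    refine mul_le_mul ((ContinuousLinearMap.le_opNorm _ _).trans ?_) (hL p) (norm_nonneg _)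
      (by positivity)
    exact mul_le_mul ((hCd _).trans (mul_le_mul_of_nonneg_left (hz θ p) hC0))
      (hrot _ _ p (by rw [abs_neg]; exact Real.abs_sin_le_one θ) (Real.abs_cos_le_one θ))
      (norm_nonneg _) (by positivity)
  · refine ((integrable_one_add_norm_pow (μ.prod μ) (k + 2)).const_mul
      (C * 3 ^ k * 2 * ‖L‖)).congr (ae_of_all _ fun p => ?_)
    simp only [mul_pow, pow_succ]
    ring
  · refine ae_of_all _ fun p θ _ => ?_
    have h1 : HasDerivAt (fun θ : ℝ => Real.cos θ • p.1 + Real.sin θ • p.2)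
        (-Real.sin θ • p.1 + Real.cos θ • p.2) θ :=
      ((Real.hasDerivAt_cos θ).smul_const p.1).add ((Real.hasDerivAt_sin θ).smul_const p.2)
    exact (((hf.1.differentiable (by simp)).differentiableAt.hasFDerivAt).comp_hasDerivAt θ
      h1).mul_const _

/-- Gaussian integration by parts (Stein's identity) for a centered Gaussian measure on a
separable Banach space. -/
theorem integral_mul_dual (μ : Measure E) [IsGaussian μ] (hμ : ∫ x, x ∂μ = 0) {f : E → ℝ}
    (hf : f.HasTemperateGrowth) (L : StrongDual ℝ E) :
    ∫ x, f x * L x ∂μ = ∫ x, fderiv ℝ f x (∫ y, L y • y ∂μ) ∂μ := by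
  have hLt : (fun x => L x).HasTemperateGrowth := L.hasTemperateGrowth
  have hfL : Integrable (fun x => f x * L x) μ :=
    integrable_of_hasTemperateGrowth μ (hf.mul hLt)
  have hfi : Integrable f μ := integrable_of_hasTemperateGrowth μ hf
  have hLi : Integrable (fun x => L x) μ := integrable_of_hasTemperateGrowth μ hLt
  have hL0 : ∫ x, L x ∂μ = 0 := by rw [integral_dual, hμ, map_zero]
  -- In rotated coordinates `(x', y')`, again distributed as `μ ⊗ μ`, one has `L y = sin θ L x' +
  -- cos θ L y'`. The second term integrates to `0` because `y'` is centered and independent of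
  -- `x'`.
  have hrot : ∀ θ : ℝ, ∫ p : E × E, f (Real.cos θ • p.1 + Real.sin θ • p.2) * L p.2
      ∂(μ.prod μ) = Real.sin θ * ∫ x, f x * L x ∂μ := by
    intro θ
    have h := integral_map (μ := μ.prod μ) (φ := ContinuousLinearMap.rotation (E := E) θ)
      (f := fun p : E × E => f p.1 * (Real.sin θ * L p.1 + Real.cos θ * L p.2))
      (ContinuousLinearMap.continuous _).aemeasurable
      (Continuous.aestronglyMeasurable (by have := hf.1.continuous; fun_prop))
    rw [map_rotation_eq_self (μ := μ) hμ] at h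
    have e1 : ∀ p : E × E, f (Real.cos θ • p.1 + Real.sin θ • p.2) * L p.2 =
        f (ContinuousLinearMap.rotation θ p).1 *
          (Real.sin θ * L (ContinuousLinearMap.rotation θ p).1
            + Real.cos θ * L (ContinuousLinearMap.rotation θ p).2) := by
      intro p
      simp only [ContinuousLinearMap.rotation_apply, map_add, map_smul, smul_eq_mul]
      congr 1
      linear_combination (- L p.2) * Real.sin_sq_add_cos_sq θ
    rw [integral_congr_ae (ae_of_all _ e1), ← h]
    have e2 : ∀ p : E × E, f p.1 * (Real.sin θ * L p.1 + Real.cos θ * L p.2) =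
        Real.sin θ * (f p.1 * L p.1) + Real.cos θ * (f p.1 * L p.2) := fun p => by ring
    rw [integral_congr_ae (ae_of_all _ e2), integral_add
      ((hfL.comp_fst μ).const_mul _) ((hfi.mul_prod hLi).const_mul _), integral_const_mul,
      integral_const_mul, integral_prod_mul, hL0, mul_zero, mul_zero, add_zero,
      integral_fun_fst (fun x => f x * L x)]
    simp
  have hd := hasDerivAt_integral_rotation μ hf L
  simp only [hrot] at hd
  have hs : HasDerivAt (fun θ => Real.sin θ * ∫ x, f x * L x ∂μ) (∫ x, f x * L x ∂μ) 0 := by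
    simpa using (Real.hasDerivAt_sin 0).mul_const (∫ x, f x * L x ∂μ)
  have hint : Integrable (fun p : E × E => fderiv ℝ f p.1 p.2 * L p.2) (μ.prod μ) := by
    refine integrable_of_hasTemperateGrowth (μ.prod μ) ?_
    have h1 : (fun p : E × E => fderiv ℝ f p.1).HasTemperateGrowth :=
      hf.fderiv.comp (ContinuousLinearMap.fst ℝ E E).hasTemperateGrowth
    have h2 : (fun p : E × E => p.2).HasTemperateGrowth :=
      (ContinuousLinearMap.snd ℝ E E).hasTemperateGrowth
    exact ((ContinuousLinearMap.id ℝ (E →L[ℝ] ℝ)).bilinear_hasTemperateGrowth h1 h2).mul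
      (hLt.comp h2)
  -- Two expressions for the derivative at `θ = 0` are equated; Fubini then lets `fderiv ℝ f x` be
  -- pulled out of the integral over `y`.
  rw [hs.unique hd, integral_prod _ hint]
  refine integral_congr_ae (ae_of_all _ fun x => ?_)
  have hLy : Integrable (fun y => L y • y) μ := by
    refine ((integrable_one_add_norm_pow μ 2).const_mul ‖L‖).mono'
      (Continuous.aestronglyMeasurable (by fun_prop)) (ae_of_all _ fun y => ?_)
    rw [norm_smul]
    calc ‖L y‖ * ‖y‖ ≤ ‖L‖ * ‖y‖ * ‖y‖ := by gcongr; exact L.le_opNorm y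
      _ ≤ ‖L‖ * (1 + ‖y‖) ^ 2 := by
        rw [mul_assoc]
        gcongr
        nlinarith [norm_nonneg y]
  change ∫ y, fderiv ℝ f x y * L y ∂μ = fderiv ℝ f x (∫ y, L y • y ∂μ)
  rw [← ContinuousLinearMap.integral_comp_comm _ hLy]
  exact integral_congr_ae (ae_of_all _ fun y => by simp [mul_comm])

end ProbabilityTheory.IsGaussian

namespace WienerForm

variable {d : ℕ}

/-! ### Integration by parts for the Wiener measure -/

variable {ν : Measure (Path d)}

/-- The joint law of the path at finitely many times. -/
def finLaw {ι : Type*} (ν : Measure (Path d)) (τ : ι → I) :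
    Measure (ι → Euc d) :=
  ν.map fun γ i => γ (τ i)

theorem measurable_evals {ι : Type*} (τ : ι → I) :
    Measurable (fun (γ : Path d) (i : ι) => γ (τ i)) :=
  measurable_pi_lambda _ fun i => measurable_eval (τ i)

theorem integral_finLaw {ι : Type*} [Fintype ι] {F : Type*} [NormedAddCommGroup F]
    [NormedSpace ℝ F] (τ : ι → I) {g : (ι → Euc d) → F} (hg : Continuous g)
    [SecondCountableTopologyEither (ι → Euc d) F] :
    ∫ x, g x ∂(finLaw ν τ) = ∫ γ, g (fun i => γ (τ i)) ∂ν :=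
  integral_map (measurable_evals τ).aemeasurable hg.aestronglyMeasurable

theorem integral_inner_mul_inner_stdGaussian (v w : Euc d) :
    ∫ x, inner ℝ x v * inner ℝ x w ∂(stdGaussian (Euc d)) = inner ℝ v w := by
  have h := covarianceBilin_apply (μ := stdGaussian (Euc d)) IsGaussian.memLp_two_id v w
  rw [covarianceBilin_stdGaussian] at h
  simp only [id, integral_id_stdGaussian, sub_zero] at h
  rw [← innerSL_apply_apply ℝ v w, h]
  exact integral_congr_ae (ae_of_all _ fun x => by simp only [real_inner_comm])

namespace IsWienerMeasure

theorem map_eval (hν : IsWienerMeasure ν) (t : I) :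
    ν.map (fun γ : Path d => γ t) =
      (stdGaussian (Euc d)).map (fun x => Real.sqrt (t : ℝ) • x) := by
  have h := hν.law_increment 0 t t.2.1
  simpa only [show ∀ γ : Path d, γ 0 = 0 from fun γ => γ.2, sub_zero, Set.Icc.coe_zero] using h

theorem isGaussianProcess (hν : IsWienerMeasure ν) :
    IsGaussianProcess (fun (t : I) (γ : Path d) => γ t) ν := by
  refine hν.hasIndepIncrements.isGaussianProcess (fun t => ⟨?_⟩) (ae_of_all _ fun γ => γ.2)
  rw [hν.map_eval t]
  exact isGaussian_map (Real.sqrt (t : ℝ) • ContinuousLinearMap.id ℝ (Euc d))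

theorem isGaussian_finLaw (hν : IsWienerMeasure ν) {ι : Type*} [Fintype ι] (τ : ι → I) :
    IsGaussian (finLaw ν τ) := by
  classical
  -- Joint Gaussianity is available on finite sets of times; a linear reindexing covers families
  -- with repetitions.
  exact ((hν.isGaussianProcess.hasGaussianLaw (Finset.univ.image τ)).map_fun
    (ContinuousLinearMap.pi fun i => ContinuousLinearMap.proj (R := ℝ)
      (φ := fun _ : (Finset.univ.image τ : Finset I) => Euc d)
      ⟨τ i, Finset.mem_image_of_mem _ (Finset.mem_univ i)⟩)).isGaussian_map

theorem integrable_of_mem_Z (hν : IsWienerMeasure ν) {F : Path d → ℝ} (hF : F ∈ Z d) :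
    Integrable F ν := by
  obtain ⟨r, rfl⟩ := hF
  have := hν.isGaussian_finLaw r.s
  have h := IsGaussian.integrable_of_hasTemperateGrowth (finLaw ν r.s) r.f_growth
  exact (integrable_map_measure r.f_growth.1.continuous.aestronglyMeasurable
    (measurable_evals r.s).aemeasurable).1 h

theorem memLp_two_eval (hν : IsWienerMeasure ν) (t : I) : MemLp (fun γ : Path d => γ t) 2 ν :=
  (hν.isGaussianProcess.hasGaussianLaw_eval t).memLp_two

theorem integral_eval (hν : IsWienerMeasure ν) (t : I) : ∫ γ : Path d, γ t ∂ν = 0 := by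
  have h : ∫ x, x ∂(ν.map (fun γ : Path d => γ t)) = ∫ γ : Path d, γ t ∂ν :=
    integral_map (measurable_eval t).aemeasurable aestronglyMeasurable_id
  rw [← h, hν.map_eval, integral_map (by fun_prop)
    (Continuous.aestronglyMeasurable (by fun_prop)), integral_smul,
    integral_id_stdGaussian, smul_zero]

theorem integral_inner_eval (hν : IsWienerMeasure ν) (t : I) (v : Euc d) :
    ∫ γ : Path d, inner ℝ (γ t) v ∂ν = 0 := by
  have := hν.isProbabilityMeasure
  have h := integral_inner ((hν.memLp_two_eval t).integrable one_le_two) v (𝕜 := ℝ)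
  simp only [hν.integral_eval t, inner_zero_right] at h
  simpa only [real_inner_comm] using h

theorem integral_inner_mul_inner_same (hν : IsWienerMeasure ν) (t : I) (v w : Euc d) :
    ∫ γ : Path d, inner ℝ (γ t) v * inner ℝ (γ t) w ∂ν = t * inner ℝ v w := by
  have h : ∫ x : Euc d, inner ℝ x v * inner ℝ x w ∂(ν.map (fun γ : Path d => γ t)) =
      ∫ γ : Path d, inner ℝ (γ t) v * inner ℝ (γ t) w ∂ν :=
    integral_map (measurable_eval t).aemeasurable (Continuous.aestronglyMeasurable (by fun_prop))
  rw [← h, hν.map_eval, integral_map (by fun_prop)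
    (Continuous.aestronglyMeasurable (by fun_prop))]
  simp only [inner_smul_left, conj_trivial]
  rw [← integral_inner_mul_inner_stdGaussian, ← integral_const_mul]
  refine integral_congr_ae (ae_of_all _ fun x => ?_)
  linear_combination (inner ℝ x v * inner ℝ x w) * Real.mul_self_sqrt t.2.1

/-- Split `γ(t) = γ(s) + (γ(t) - γ(s))`: the increment is centered and independent of `γ(s)`, so
only the first summand contributes. -/
theorem integral_inner_mul_inner_of_le (hν : IsWienerMeasure ν) {s t : I} (hst : s ≤ t)
    (v w : Euc d) :
    ∫ γ : Path d, inner ℝ (γ s) v * inner ℝ (γ t) w ∂ν = s * inner ℝ v w := by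
  have hi : (fun γ : Path d => γ s) ⟂ᵢ[ν] (fun γ : Path d => γ t - γ s) :=
    hν.hasIndepIncrements.indepFun_eval_sub s.2.1 hst (ae_of_all _ fun γ => γ.2)
  have hi2 : (fun γ : Path d => inner ℝ (γ s) v) ⟂ᵢ[ν]
      (fun γ : Path d => inner ℝ (γ t - γ s) w) :=
    hi.comp (φ := fun x : Euc d => inner ℝ x v) (ψ := fun x : Euc d => inner ℝ x w)
      (by fun_prop) (by fun_prop)
  have h0 : ∫ γ : Path d, inner ℝ (γ t - γ s) w ∂ν = 0 := by
    simp only [inner_sub_left]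
    rw [integral_sub (hν.integrable_of_mem_Z (inner_eval_mem_Z t w))
      (hν.integrable_of_mem_Z (inner_eval_mem_Z s w)), hν.integral_inner_eval,
      hν.integral_inner_eval, sub_zero]
  have hm := hi2.integral_fun_mul_eq_mul_integral
    (measurable_of_mem_Z (inner_eval_mem_Z s v)).aestronglyMeasurable
    (((measurable_eval t).sub (measurable_eval s)).inner measurable_const).aestronglyMeasurable
  rw [h0, mul_zero] at hm
  rw [← hν.integral_inner_mul_inner_same s v w, ← sub_eq_zero, ← integral_sub
    (hν.integrable_of_mem_Z (mul_mem_Z (inner_eval_mem_Z s v) (inner_eval_mem_Z t w)))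
    (hν.integrable_of_mem_Z (mul_mem_Z (inner_eval_mem_Z s v) (inner_eval_mem_Z s w))), ← hm]
  refine integral_congr_ae (ae_of_all _ fun γ => ?_)
  simp only [inner_sub_left]
  ring

theorem integral_inner_mul_inner (hν : IsWienerMeasure ν) (s t : I) (v w : Euc d) :
    ∫ γ : Path d, inner ℝ (γ s) v * inner ℝ (γ t) w ∂ν =
      min (s : ℝ) (t : ℝ) * inner ℝ v w := by
  rcases le_total s t with h | h
  · rw [hν.integral_inner_mul_inner_of_le h, min_eq_left (Subtype.coe_le_coe.2 h)]
  · simp only [mul_comm (inner ℝ (_ : Euc d) v)]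
    rw [hν.integral_inner_mul_inner_of_le h, min_eq_right (Subtype.coe_le_coe.2 h),
      real_inner_comm]

/-- The covariance operator applied to the functional `x ↦ ⟨x j, v⟩` is the ramp at time `τ j`
sampled at all times. Stein's identity therefore differentiates in exactly the direction used by
`gradIn`. -/
theorem integral_inner_smul_finLaw (hν : IsWienerMeasure ν) {ι : Type*} [Fintype ι]
    (τ : ι → I) (j : ι) (v : Euc d) :
    ∫ x, inner ℝ (x j) v • x ∂(finLaw ν τ) = fun i => min (τ i : ℝ) (τ j : ℝ) • v := by
  have := hν.isGaussian_finLaw τ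
  have hcoord : ∀ i w, Integrable
      (fun x : ι → Euc d => inner ℝ (x i) w * inner ℝ (x j) v) (finLaw ν τ) := by
    intro i w
    refine IsGaussian.integrable_of_hasTemperateGrowth _ (.mul ?_ ?_)
    · exact (((innerSL ℝ).flip w).comp (ContinuousLinearMap.proj (R := ℝ)
        (φ := fun _ : ι => Euc d) i)).hasTemperateGrowth
    · exact (((innerSL ℝ).flip v).comp (ContinuousLinearMap.proj (R := ℝ)
        (φ := fun _ : ι => Euc d) j)).hasTemperateGrowth
  have hint : Integrable (fun x : ι → Euc d => inner ℝ (x j) v • x) (finLaw ν τ) := by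
    refine ((IsGaussian.integrable_one_add_norm_pow (finLaw ν τ) 2).const_mul ‖v‖).mono'
      (Continuous.aestronglyMeasurable (by fun_prop)) (ae_of_all _ fun x => ?_)
    rw [norm_smul]
    calc ‖inner ℝ (x j) v‖ * ‖x‖ ≤ (‖x‖ * ‖v‖) * ‖x‖ := by
          gcongr
          exact (norm_inner_le_norm _ _).trans (by gcongr; exact norm_le_pi_norm x j)
      _ ≤ ‖v‖ * (1 + ‖x‖) ^ 2 := by
        rw [mul_comm ‖x‖ ‖v‖, mul_assoc]
        gcongr
        nlinarith [norm_nonneg x]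
  funext i
  refine ext_inner_right ℝ fun w => ?_
  have h := (((innerSL ℝ).flip w).comp (ContinuousLinearMap.proj (R := ℝ)
    (φ := fun _ : ι => Euc d) i)).integral_comp_comm hint
  simp only [ContinuousLinearMap.comp_apply, ContinuousLinearMap.flip_apply,
    ContinuousLinearMap.proj_apply, innerSL_apply_apply, Pi.smul_apply, inner_smul_left,
    conj_trivial] at h
  rw [← h, integral_finLaw τ (by fun_prop), inner_smul_left, conj_trivial,
    hν.integral_inner_mul_inner, min_comm, real_inner_comm]

/-- Integration by parts: the adjoint of `F ↦ ⟨D_t F, v⟩` at the constant function. -/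
theorem integral_gradIn (hν : IsWienerMeasure ν) {F : Path d → ℝ} (hF : F ∈ Z d) (t : I)
    (v : Euc d) : ∫ γ, gradIn t v F γ ∂ν = ∫ γ, F γ * inner ℝ (γ t) v ∂ν := by
  obtain ⟨r, rfl⟩ := hF
  -- Adjoining `t` as the extra time `none` makes `⟨γ(t), v⟩` a linear functional of the sampled
  -- path; `g` ignores that coordinate.
  set τ : Option (Fin (r.n + 1)) → I := fun o => o.elim t r.s with hτ
  have := hν.isGaussian_finLaw τ
  have hpi : (fun (x : Option (Fin (r.n + 1)) → Euc d) i => x (some i)).HasTemperateGrowth :=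
    (ContinuousLinearMap.pi fun i => ContinuousLinearMap.proj (R := ℝ)
      (φ := fun _ : Option (Fin (r.n + 1)) => Euc d) (some i)).hasTemperateGrowth
  set g : (Option (Fin (r.n + 1)) → Euc d) → ℝ := fun x => r.f fun i => x (some i) with hg
  have hgt : g.HasTemperateGrowth := r.f_growth.comp hpi
  set L : StrongDual ℝ (Option (Fin (r.n + 1)) → Euc d) :=
    ((innerSL ℝ).flip v).comp (ContinuousLinearMap.proj (R := ℝ)
      (φ := fun _ : Option (Fin (r.n + 1)) => Euc d) none) with hL
  have hLx : ∀ x, L x = inner ℝ (x none) v := fun x => rfl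
  have h0 : ∫ x, x ∂(finLaw ν τ) = 0 := by
    funext i
    have h := (ContinuousLinearMap.proj (R := ℝ) (φ := fun _ : Option (Fin (r.n + 1)) => Euc d)
      i).integral_comp_comm (IsGaussian.integrable_fun_id (μ := finLaw ν τ))
    simp only [ContinuousLinearMap.proj_apply] at h
    rw [← h, integral_finLaw τ (by fun_prop), hν.integral_eval, Pi.zero_apply]
  have key := IsGaussian.integral_mul_dual (finLaw ν τ) h0 hgt L
  have hgc := hgt.1.continuous
  have hdc : Continuous (fderiv ℝ g) := hgt.1.continuous_fderiv (by simp)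
  simp only [hLx, hν.integral_inner_smul_finLaw τ none v] at key
  rw [integral_finLaw τ (by fun_prop), integral_finLaw τ (by fun_prop)] at key
  refine Eq.trans ?_ key.symm
  exact integral_congr_ae (ae_of_all _ fun γ => gradIn_of_finite τ hgt t v γ)

/-- Leibniz rule inside `integral_gradIn` for the product `F G`. -/
theorem integral_gradIn_mul (hν : IsWienerMeasure ν) {F G : Path d → ℝ} (hF : F ∈ Z d)
    (hG : G ∈ Z d) (t : I) (v : Euc d) :
    ∫ γ, gradIn t v F γ * G γ ∂ν =
      ∫ γ, F γ * (G γ * inner ℝ (γ t) v - gradIn t v G γ) ∂ν := by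
  have h := hν.integral_gradIn (mul_mem_Z hF hG) t v
  simp only [gradIn_mul hF hG] at h
  rw [integral_add (hν.integrable_of_mem_Z (mul_mem_Z (gradIn_mem_Z hF t v) hG))
    (hν.integrable_of_mem_Z (mul_mem_Z hF (gradIn_mem_Z hG t v))), ← eq_sub_iff_add_eq,
    ← integral_sub (hν.integrable_of_mem_Z (mul_mem_Z (mul_mem_Z hF hG) (inner_eval_mem_Z t v)))
    (hν.integrable_of_mem_Z (mul_mem_Z hF (gradIn_mem_Z hG t v)))] at h
  rw [h]
  exact integral_congr_ae (ae_of_all _ fun γ => by ring)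

end IsWienerMeasure

end WienerForm

/-! ### Weak convergence tested on a total set -/

/-- The span of `S` is dense, its orthogonal complement being trivial; the norm bound makes the
error of approximating `z` from the span uniform in `n`. -/
theorem tendsto_inner_zero_of_total {H : Type*} [NormedAddCommGroup H] [InnerProductSpace ℝ H]
    [CompleteSpace H] {x : ℕ → H} {M : ℝ} (hx : ∀ᶠ n in atTop, ‖x n‖ ≤ M) {S : Set H}
    (hS : ∀ y : H, (∀ g ∈ S, inner ℝ g y = 0) → y = 0)
    (h : ∀ g ∈ S, Tendsto (fun n => inner ℝ (x n) g) atTop (𝓝 0)) (z : H) :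
    Tendsto (fun n => inner ℝ (x n) z) atTop (𝓝 0) := by
  have hspan : ∀ g ∈ Submodule.span ℝ S, Tendsto (fun n => inner ℝ (x n) g) atTop (𝓝 0) := by
    intro g hg
    induction hg using Submodule.span_induction with
    | mem g hg => exact h g hg
    | zero => simp
    | add a b _ _ ha hb => simpa only [inner_add_right, add_zero] using ha.add hb
    | smul c a _ ha => simpa only [inner_smul_right, mul_zero] using ha.const_mul c
  have hdense : (Submodule.span ℝ S).topologicalClosure = ⊤ := by
    rw [Submodule.topologicalClosure_eq_top_iff, Submodule.eq_bot_iff]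
    exact fun y hy => hS y fun g hg => hy g (Submodule.subset_span hg)
  rw [Metric.tendsto_atTop']
  intro ε hε
  have hz : z ∈ closure (Submodule.span ℝ S : Set H) := by
    rw [← Submodule.topologicalClosure_coe, hdense]
    trivial
  obtain ⟨g, hg, hzg⟩ := Metric.mem_closure_iff.1 hz (ε / (2 * (|M| + 1))) (by positivity)
  have hev := (hspan g hg).eventually (Metric.ball_mem_nhds 0 (half_pos hε))
  obtain ⟨N, hN⟩ := eventually_atTop.1 (hx.and hev)
  refine ⟨N, fun n hn => ?_⟩
  obtain ⟨h1, h2⟩ := hN n hn.le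
  rw [dist_zero_right] at h2 ⊢
  rw [dist_eq_norm] at hzg
  have h3 : ‖inner ℝ (x n) (z - g)‖ ≤ |M| * (ε / (2 * (|M| + 1))) :=
    (norm_inner_le_norm _ _).trans
      (mul_le_mul (h1.trans (le_abs_self M)) hzg.le (norm_nonneg _) (abs_nonneg _))
  have h4 : |M| * (ε / (2 * (|M| + 1))) ≤ ε / 2 := by
    rw [mul_div_assoc', div_le_div_iff₀ (by positivity) two_pos]
    nlinarith [abs_nonneg M]
  have h5 : inner ℝ (x n) z = inner ℝ (x n) (z - g) + inner ℝ (x n) g := by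
    rw [inner_sub_right]; ring
  rw [h5]
  linarith [norm_add_le (inner ℝ (x n) (z - g)) (inner ℝ (x n) g)]

theorem inner_toLp_eq_integral {Ω : Type*} [MeasurableSpace Ω] {μ : Measure Ω} {f g : Ω → ℝ}
    (hf : MemLp f 2 μ) (hg : MemLp g 2 μ) :
    inner ℝ (hf.toLp f) (hg.toLp g) = ∫ x, f x * g x ∂μ := by
  rw [L2.inner_def]
  refine integral_congr_ae ?_
  filter_upwards [hf.coeFn_toLp, hg.coeFn_toLp] with x h1 h2
  rw [h1, h2]
  simp [mul_comm]

/-! ### Trigonometric test functions -/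

theorem Real.hasTemperateGrowth_cos : Real.cos.HasTemperateGrowth :=
  ⟨Real.contDiff_cos, fun n => ⟨0, 1, fun x => by
    rw [norm_iteratedFDeriv_eq_norm_iteratedDeriv]
    simpa using Real.abs_iteratedDeriv_cos_le_one n x⟩⟩

theorem Real.hasTemperateGrowth_sin : Real.sin.HasTemperateGrowth :=
  ⟨Real.contDiff_sin, fun n => ⟨0, 1, fun x => by
    rw [norm_iteratedFDeriv_eq_norm_iteratedDeriv]
    simpa using Real.abs_iteratedDeriv_sin_le_one n x⟩⟩

namespace WienerForm

variable {d : ℕ} {ν : Measure (Path d)}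

/-! ### Cylindrical functions separate integrable functions -/

/-- Finite measures on path space with the same finite-dimensional marginals agree. -/
theorem ext_of_finLaw {μ₁ μ₂ : Measure (Path d)} [IsFiniteMeasure μ₁] [IsFiniteMeasure μ₂]
    (h : ∀ J : Finset I, finLaw μ₁ (fun j : J => (j : I)) = finLaw μ₂ (fun j : J => (j : I))) :
    μ₁ = μ₂ := by
  have hm : Measurable (fun (γ : Path d) (t : I) => γ t) := measurable_evals id
  have hp : ∀ μ : Measure (Path d), IsProjectiveLimit (μ.map fun (γ : Path d) (t : I) => γ t)
      (fun J => finLaw μ (fun j : J => (j : I))) := by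
    intro μ J
    rw [Measure.map_map (Finset.measurable_restrict J) hm]
    rfl
  have hfin : ∀ J : Finset I, IsFiniteMeasure (finLaw μ₁ (fun j : J => (j : I))) := fun J =>
    Measure.isFiniteMeasure_map _ _
  have h2 := hp μ₂
  simp only [← h] at h2
  have heq := (hp μ₁).unique h2
  refine Measure.ext fun s hs => ?_
  -- Every measurable set of paths is the trace of one in the product space, so equality of the
  -- projective limits transfers back.
  have hle : (inferInstance : MeasurableSpace (Path d)) ≤
      MeasurableSpace.comap (fun (γ : Path d) (t : I) => γ t) inferInstance := by
    refine iSup_le fun t => ?_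
    rintro _ ⟨A, hA, rfl⟩
    exact ⟨(fun x => x t) ⁻¹' A, measurable_pi_apply t hA, rfl⟩
  obtain ⟨A, hA, rfl⟩ := hle s hs
  rw [← Measure.map_apply hm hA, ← Measure.map_apply hm hA, heq]

/-- The finite measures `y⁺ν` and `y⁻ν` have equal characteristic functions on all
finite-dimensional marginals, because `cos` and `sin` of linear functionals of the path values lie
in `Z`. So they agree, and `y⁺ = y⁻` almost everywhere. -/
theorem ae_eq_zero_of_forall_mem_Z {y : Path d → ℝ} (hy : Integrable y ν)
    (h : ∀ G ∈ Z d, ∫ γ, y γ * G γ ∂ν = 0) : y =ᵐ[ν] 0 := by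
  have hpos : AEMeasurable (fun γ => ENNReal.ofReal (y γ)) ν := hy.aemeasurable.ennreal_ofReal
  have hneg : AEMeasurable (fun γ => ENNReal.ofReal (-y γ)) ν :=
    hy.aemeasurable.neg.ennreal_ofReal
  have hpf : ∫⁻ γ, ENNReal.ofReal (y γ) ∂ν ≠ ⊤ :=
    ((lintegral_mono fun γ => Real.ofReal_le_enorm (y γ)).trans_lt hy.2).ne
  have i1 := isFiniteMeasure_withDensity_ofReal hy.2
  have i2 : IsFiniteMeasure (ν.withDensity fun γ => ENNReal.ofReal (-y γ)) :=
    isFiniteMeasure_withDensity_ofReal hy.neg.2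
  have key : ν.withDensity (fun γ => ENNReal.ofReal (y γ)) =
      ν.withDensity (fun γ => ENNReal.ofReal (-y γ)) := by
    refine ext_of_finLaw fun J => ?_
    have i3 : IsFiniteMeasure (finLaw (ν.withDensity fun γ => ENNReal.ofReal (y γ))
      (fun j : J => (j : I))) := Measure.isFiniteMeasure_map _ _
    have i4 : IsFiniteMeasure (finLaw (ν.withDensity fun γ => ENNReal.ofReal (-y γ))
      (fun j : J => (j : I))) := Measure.isFiniteMeasure_map _ _
    refine Measure.ext_of_charFunDual (funext fun L => ?_)
    set θ : Path d → ℝ := fun γ => L fun j : J => γ (j : I) with hθ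
    have hcos : (fun γ => Real.cos (θ γ)) ∈ Z d :=
      mem_Z_of_finite (fun j : J => (j : I)) (g := fun x => Real.cos (L x))
        (Real.hasTemperateGrowth_cos.comp L.hasTemperateGrowth)
    have hsin : (fun γ => Real.sin (θ γ)) ∈ Z d :=
      mem_Z_of_finite (fun j : J => (j : I)) (g := fun x => Real.sin (L x))
        (Real.hasTemperateGrowth_sin.comp L.hasTemperateGrowth)
    have hθm : Measurable θ := L.continuous.measurable.comp (measurable_evals _)
    have hexp : Measurable (fun γ => Complex.exp (θ γ * Complex.I)) := by fun_prop
    have hint : ∀ u : Path d → ℝ, Integrable u ν →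
        Integrable (fun γ => u γ • Complex.exp (θ γ * Complex.I)) ν := fun u hu =>
      hu.smul_bdd 1 hexp.aestronglyMeasurable
        (ae_of_all _ fun γ => (Complex.norm_exp_ofReal_mul_I _).le)
    have hc : Integrable (fun γ => y γ * Real.cos (θ γ)) ν :=
      hy.mul_bdd (c := 1) (measurable_of_mem_Z hcos).aestronglyMeasurable
        (ae_of_all _ fun γ => Real.abs_cos_le_one _)
    have hs : Integrable (fun γ => y γ * Real.sin (θ γ)) ν :=
      hy.mul_bdd (c := 1) (measurable_of_mem_Z hsin).aestronglyMeasurable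
        (ae_of_all _ fun γ => Real.abs_sin_le_one _)
    have hzero : ∫ γ, y γ • Complex.exp (θ γ * Complex.I) ∂ν = 0 := by
      have e : ∀ γ, y γ • Complex.exp (θ γ * Complex.I) =
          ((y γ * Real.cos (θ γ) : ℝ) : ℂ) + ((y γ * Real.sin (θ γ) : ℝ) : ℂ) * Complex.I := by
        intro γ
        rw [Complex.exp_mul_I, Complex.real_smul]
        push_cast
        ring
      rw [integral_congr_ae (ae_of_all _ e), integral_add hc.ofReal (hs.ofReal.mul_const _),
        integral_mul_const, integral_complex_ofReal, integral_complex_ofReal, h _ hcos,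
        h _ hsin]
      simp
    have hfc : ∀ μ : Measure (Path d), charFunDual (finLaw μ fun j : J => (j : I)) L =
        ∫ γ, Complex.exp (θ γ * Complex.I) ∂μ := by
      intro μ
      rw [charFunDual_apply]
      exact integral_map (measurable_evals _).aemeasurable
        (Continuous.aestronglyMeasurable (by fun_prop))
    rw [hfc, hfc,
      integral_withDensity_eq_integral_toReal_smul₀ hpos
        (ae_of_all _ fun _ => ENNReal.ofReal_lt_top),
      integral_withDensity_eq_integral_toReal_smul₀ hneg
        (ae_of_all _ fun _ => ENNReal.ofReal_lt_top),
      ← sub_eq_zero]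
    simp only [ENNReal.toReal_ofReal']
    rw [← integral_sub (hint _ hy.pos_part) (hint (fun γ => max (-y γ) 0) hy.neg.pos_part),
      ← hzero]
    refine integral_congr_ae (ae_of_all _ fun γ => ?_)
    simp only [← sub_smul]
    congr 1
    rcases le_total 0 (y γ) with h0 | h0
    · rw [max_eq_left h0, max_eq_right (by linarith), sub_zero]
    · rw [max_eq_right h0, max_eq_left (by linarith), zero_sub, neg_neg]
  filter_upwards [(withDensity_eq_iff hpos hneg hpf).1 key] with γ hγ
  rcases le_total 0 (y γ) with h0 | h0
  · rw [ENNReal.ofReal_of_nonpos (by linarith : -y γ ≤ 0), ENNReal.ofReal_eq_zero] at hγ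
    exact le_antisymm hγ h0
  · rw [ENNReal.ofReal_of_nonpos h0, eq_comm, ENNReal.ofReal_eq_zero] at hγ
    exact le_antisymm h0 (by simpa using hγ)

end WienerForm

namespace WienerForm

variable {d : ℕ} {ν : Measure (Path d)} {φ : Path d → ℝ} {c : ℝ}

/-! ### Weighted measures -/

/-- A bounded positive weight `φ` such that `F / φ` is integrable for every `F ∈ Z`. -/
structure IsAdmissibleWeight (ν : Measure (Path d)) (φ : Path d → ℝ) (c : ℝ) : Prop where
  aemeasurable : AEMeasurable φ ν
  pos_le : ∀ᵐ γ ∂ν, 0 < φ γ ∧ φ γ ≤ c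
  integrable_div : ∀ F ∈ Z d, Integrable (fun γ => F γ / φ γ) ν

namespace IsAdmissibleWeight

theorem ae_pos (hφ : IsAdmissibleWeight ν φ c) : ∀ᵐ γ ∂ν, 0 < φ γ :=
  hφ.pos_le.mono fun _ h => h.1

theorem integrable_weighted_iff (hφ : IsAdmissibleWeight ν φ c) {h : Path d → ℝ} :
    Integrable h (weighted ν φ) ↔ Integrable (fun γ => h γ * φ γ) ν := by
  rw [weighted, integrable_withDensity_iff_integrable_smul₀' hφ.aemeasurable.ennreal_ofReal
    (ae_of_all _ fun _ => ENNReal.ofReal_lt_top)]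
  refine integrable_congr ?_
  filter_upwards [hφ.ae_pos] with γ hγ
  rw [ENNReal.toReal_ofReal hγ.le, smul_eq_mul, mul_comm]

theorem integral_weighted (hφ : IsAdmissibleWeight ν φ c) (h : Path d → ℝ) :
    ∫ γ, h γ ∂(weighted ν φ) = ∫ γ, h γ * φ γ ∂ν := by
  rw [weighted, integral_withDensity_eq_integral_toReal_smul₀ hφ.aemeasurable.ennreal_ofReal
    (ae_of_all _ fun _ => ENNReal.ofReal_lt_top)]
  refine integral_congr_ae ?_
  filter_upwards [hφ.ae_pos] with γ hγ
  rw [ENNReal.toReal_ofReal hγ.le, smul_eq_mul, mul_comm]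

theorem absolutelyContinuous (_ : IsAdmissibleWeight ν φ c) : weighted ν φ ≪ ν :=
  withDensity_absolutelyContinuous _ _

theorem integrable_mul (hφ : IsAdmissibleWeight ν φ c) (hν : IsWienerMeasure ν)
    {F : Path d → ℝ} (hF : F ∈ Z d) : Integrable (fun γ => F γ * φ γ) ν := by
  refine (hν.integrable_of_mem_Z hF).mul_bdd (c := c) hφ.aemeasurable.aestronglyMeasurable ?_
  filter_upwards [hφ.pos_le] with γ hγ
  rw [Real.norm_of_nonneg hγ.1.le]
  exact hγ.2

theorem memLp_two (hφ : IsAdmissibleWeight ν φ c) (hν : IsWienerMeasure ν)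
    {F : Path d → ℝ} (hF : F ∈ Z d) : MemLp F 2 (weighted ν φ) := by
  rw [memLp_two_iff_integrable_sq (measurable_of_mem_Z hF).aestronglyMeasurable,
    hφ.integrable_weighted_iff]
  simp only [sq]
  exact hφ.integrable_mul hν (mul_mem_Z hF hF)

/-- `(F / φ)² φ = F² / φ` with `F² ∈ Z`: this is where the integrability of `F / φ` over all of `Z`
enters. -/
theorem memLp_two_div (hφ : IsAdmissibleWeight ν φ c) {F : Path d → ℝ} (hF : F ∈ Z d) :
    MemLp (fun γ => F γ / φ γ) 2 (weighted ν φ) := by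
  rw [memLp_two_iff_integrable_sq
    ((hφ.integrable_div F hF).aestronglyMeasurable.mono_ac hφ.absolutelyContinuous),
    hφ.integrable_weighted_iff]
  refine (hφ.integrable_div _ (mul_mem_Z hF hF)).congr ?_
  filter_upwards [hφ.ae_pos] with γ hγ
  field_simp

theorem integrable_inner_grad (hφ : IsAdmissibleWeight ν φ c) (hν : IsWienerMeasure ν)
    {F G : Path d → ℝ} (hF : F ∈ Z d) (hG : G ∈ Z d) :
    Integrable (fun γ => cmInner (malliavinGrad F γ) (malliavinGrad G γ) * φ γ) ν :=
  hφ.integrable_mul hν (cmInner_malliavinGrad_mem_Z hF hG)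

/-! ### Closability -/

/-- The weight cancels, leaving an integral against `ν` itself, where integration by parts is
available without differentiating `φ`. -/
theorem inner_toLp_div (hφ : IsAdmissibleWeight ν φ c) {f G : Path d → ℝ}
    (hf : MemLp f 2 (weighted ν φ)) (hG : G ∈ Z d) :
    inner ℝ (hf.toLp f) ((hφ.memLp_two_div hG).toLp _) = ∫ γ, f γ * G γ ∂ν := by
  rw [inner_toLp_eq_integral, hφ.integral_weighted]
  refine integral_congr_ae ?_
  filter_upwards [hφ.ae_pos] with γ hγ
  field_simp

/-- The functions `G / φ` with `G ∈ Z` are total in `L²(φν)`. -/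
theorem eq_zero_of_inner_div_eq_zero (hφ : IsAdmissibleWeight ν φ c)
    (y : Lp ℝ 2 (weighted ν φ))
    (hy : ∀ G (hG : G ∈ Z d), inner ℝ ((hφ.memLp_two_div hG).toLp _) y = 0) : y = 0 := by
  have hyL : MemLp y 2 (weighted ν φ) := Lp.memLp y
  have hyi : Integrable y ν := by
    -- `y = y · (1 / φ) · φ` is a product of two `L²(φν)` functions times the density, hence in
    -- `L¹(ν)`.
    have h := hyL.integrable_mul (hφ.memLp_two_div (const_mem_Z 1))
    rw [hφ.integrable_weighted_iff] at h
    refine h.congr ?_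
    filter_upwards [hφ.ae_pos] with γ hγ
    simp only [Pi.mul_apply]
    field_simp
  have h0 : (y : Path d → ℝ) =ᵐ[ν] 0 := by
    refine ae_eq_zero_of_forall_mem_Z hyi fun G hG => ?_
    rw [← hφ.inner_toLp_div hyL hG, Lp.toLp_coeFn, real_inner_comm]
    exact hy G hG
  have h1 : (y : Path d → ℝ) =ᵐ[weighted ν φ] 0 := hφ.absolutelyContinuous.ae_le h0
  exact Lp.ext (EventuallyEq.trans h1 (Lp.coeFn_zero ℝ 2 _).symm)

theorem gradForm_self_nonneg (hφ : IsAdmissibleWeight ν φ c) (F : Path d → ℝ) :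
    0 ≤ gradForm ν φ F F := by
  refine mul_nonneg (by norm_num) (integral_nonneg_of_ae ?_)
  filter_upwards [hφ.ae_pos] with γ hγ
  exact mul_nonneg (cmInner_self_nonneg _) hγ.le

theorem gradForm_sub (hφ : IsAdmissibleWeight ν φ c) (hν : IsWienerMeasure ν)
    {F G : Path d → ℝ} (hF : F ∈ Z d) (hG : G ∈ Z d) :
    gradForm ν φ (F - G) (F - G) =
      gradForm ν φ F F - 2 * gradForm ν φ F G + gradForm ν φ G G := by
  have e : ∀ γ, cmInner (malliavinGrad (F - G) γ) (malliavinGrad (F - G) γ) * φ γ =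
      cmInner (malliavinGrad F γ) (malliavinGrad F γ) * φ γ
        - 2 * (cmInner (malliavinGrad F γ) (malliavinGrad G γ) * φ γ)
        + cmInner (malliavinGrad G γ) (malliavinGrad G γ) * φ γ := fun γ => by
    rw [cmInner_malliavinGrad_sub hF hG]; ring
  have h1 := hφ.integrable_inner_grad hν hF hF
  have h2 := (hφ.integrable_inner_grad hν hF hG).const_mul 2
  have h3 := hφ.integrable_inner_grad hν hG hG
  simp only [gradForm, integral_congr_ae (ae_of_all _ e)]
  rw [integral_add (f := fun γ => cmInner (malliavinGrad F γ) (malliavinGrad F γ) * φ γ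
      - 2 * (cmInner (malliavinGrad F γ) (malliavinGrad G γ) * φ γ)) (h1.sub h2) h3,
    integral_sub h1 h2, integral_const_mul]
  ring

theorem sq_norm_toLp_gradIn_le (hφ : IsAdmissibleWeight ν φ c) (hν : IsWienerMeasure ν)
    {F : Path d → ℝ} (hF : F ∈ Z d) (t : I) (a : Fin d) :
    ‖(hφ.memLp_two hν (gradIn_mem_Z hF t (unitVec a))).toLp _‖ ^ 2 ≤ 2 * gradForm ν φ F F := by
  have hG := gradIn_mem_Z hF t (unitVec a)
  rw [← real_inner_self_eq_norm_sq, inner_toLp_eq_integral, hφ.integral_weighted, gradForm,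
    ← mul_assoc, mul_one_div_cancel two_ne_zero, one_mul]
  refine integral_mono_ae (hφ.integrable_mul hν (mul_mem_Z hG hG))
    (hφ.integrable_inner_grad hν hF hF) ?_
  filter_upwards [hφ.ae_pos] with γ hγ
  refine mul_le_mul_of_nonneg_right ?_ hγ.le
  rw [← sq]
  exact sq_gradIn_le hF t a γ

/-- Along a form-Cauchy sequence converging to `0` in `L²(φν)`, the directional derivatives
converge weakly to `0` in `L²(φν)`. -/
theorem tendsto_integral_gradIn (hφ : IsAdmissibleWeight ν φ c) (hν : IsWienerMeasure ν)
    {u : ℕ → Path d → ℝ} (hu : ∀ n, u n ∈ Z d) (h0 : TendstoL2 (weighted ν φ) u 0)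
    (hC : FormCauchy (gradForm ν φ) u) (t : I) (a : Fin d) {ψ : Path d → ℝ} (hψ : ψ ∈ Z d) :
    Tendsto (fun n => ∫ γ, gradIn t (unitVec a) (u n) γ * ψ γ * φ γ ∂ν) atTop (𝓝 0) := by
  have hX := fun n => hφ.memLp_two hν (gradIn_mem_Z (hu n) t (unitVec a))
  obtain ⟨N, hN⟩ : ∃ N, ∀ n, N ≤ n → gradForm ν φ (u n - u N) (u n - u N) ≤ 1 := by
    have h1 := hC.eventually (ge_mem_nhds zero_lt_one)
    obtain ⟨N, h2⟩ := eventually_atTop_prod_self'.1 h1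
    exact ⟨N, fun n hn => h2 n hn N le_rfl⟩
  -- The constant `2` comes from `‖∂uₙ - ∂u_N‖² ≤ 2 𝒟(uₙ - u_N, uₙ - u_N) ≤ 2 ≤ 2²`.
  have hbd : ∀ᶠ n in atTop, ‖(hX n).toLp _‖ ≤ 2 + ‖(hX N).toLp _‖ := by
    filter_upwards [eventually_ge_atTop N] with n hn
    have h1 := hφ.sq_norm_toLp_gradIn_le hν ((Z d).sub_mem (hu n) (hu N)) t a
    have h2 : ‖(hX n).toLp _ - (hX N).toLp _‖ ^ 2 ≤ 2 ^ 2 := by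
      rw [← MemLp.toLp_sub]
      simp only [gradIn_sub (hu n) (hu N)] at h1
      linarith [hN n hn]
    have h3 := le_of_sq_le_sq h2 two_pos.le
    linarith [norm_sub_norm_le ((hX n).toLp _) ((hX N).toLp _)]
  have hnorm : Tendsto (fun n => ‖(hφ.memLp_two hν (hu n)).toLp (u n)‖) atTop (𝓝 0) := by
    simp only [Lp.norm_toLp]
    have h1 := (ENNReal.tendsto_toReal ENNReal.zero_ne_top).comp h0
    simpa only [Function.comp_def, sub_zero, ENNReal.toReal_zero] using h1
  have key := tendsto_inner_zero_of_total hbd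
    (S := {g | ∃ (G : Path d → ℝ) (hG : G ∈ Z d), g = (hφ.memLp_two_div hG).toLp _})
    (fun y hy => hφ.eq_zero_of_inner_div_eq_zero y fun G hG => hy _ ⟨G, hG, rfl⟩) ?_
    ((hφ.memLp_two hν hψ).toLp ψ)
  · simpa only [inner_toLp_eq_integral, hφ.integral_weighted] using key
  · rintro _ ⟨G, hG, rfl⟩
    have hK : (fun γ => G γ * inner ℝ (γ t) (unitVec a) - gradIn t (unitVec a) G γ) ∈ Z d :=
      (Z d).sub_mem (mul_mem_Z hG (inner_eval_mem_Z t _)) (gradIn_mem_Z hG t _)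
    -- Integration by parts moves the derivative off `u n`; Cauchy–Schwarz and `u n → 0` then
    -- finish.
    have e : ∀ n, inner ℝ ((hX n).toLp _) ((hφ.memLp_two_div hG).toLp _) =
        inner ℝ ((hφ.memLp_two hν (hu n)).toLp (u n)) ((hφ.memLp_two_div hK).toLp _) := by
      intro n
      rw [hφ.inner_toLp_div _ hG, hφ.inner_toLp_div _ hK, hν.integral_gradIn_mul (hu n) hG]
    simp only [e]
    refine squeeze_zero_norm (fun n => norm_inner_le_norm _ _) ?_
    simpa only [zero_mul] using hnorm.mul_const _

theorem gradForm_eq_sum (hφ : IsAdmissibleWeight ν φ c) (hν : IsWienerMeasure ν)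
    {F : Path d → ℝ} (hF : F ∈ Z d) (r : Cyl d) :
    gradForm ν φ F r.toFun = (1 / 2) * ∑ i, ∑ a,
      ∫ γ, gradIn (r.s i) (unitVec a) F γ * r.coordDeriv i a γ * φ γ ∂ν := by
  rw [gradForm]
  congr 1
  simp only [cmInner_comm _ (malliavinGrad r.toFun _), cmInner_malliavinGrad_eq_sum r hF,
    Finset.sum_mul]
  have hi : ∀ i a, Integrable
      (fun γ => gradIn (r.s i) (unitVec a) F γ * r.coordDeriv i a γ * φ γ) ν := fun i a =>
    hφ.integrable_mul hν (mul_mem_Z (gradIn_mem_Z hF _ _) (r.coordDeriv_mem_Z i a))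
  rw [integral_finsetSum _ fun i _ => integrable_finsetSum _ fun a _ => hi i a]
  exact Finset.sum_congr rfl fun i _ => integral_finsetSum _ fun a _ => hi i a

/-- For fixed `m` the cross term `𝒟(uₙ, uₘ)` vanishes in the limit by weak convergence, tested on
the partial derivatives of `uₘ`. Positivity gives `𝒟(uₘ, uₘ) ≤ 𝒟(uₙ - uₘ, uₙ - uₘ) + 2 𝒟(uₙ, uₘ)`,
and `n → ∞` concludes. -/
theorem isClosable (hφ : IsAdmissibleWeight ν φ c) (hν : IsWienerMeasure ν) :
    IsClosable (weighted ν φ) (Z d) (gradForm ν φ) := by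
  intro u hu h0 hC
  have hcross : ∀ m, Tendsto (fun n => gradForm ν φ (u n) (u m)) atTop (𝓝 0) := by
    intro m
    obtain ⟨r, hr⟩ := hu m
    simp only [← hr, hφ.gradForm_eq_sum hν (hu _) r]
    have h := (tendsto_finsetSum Finset.univ fun i _ => tendsto_finsetSum Finset.univ fun a _ =>
      hφ.tendsto_integral_gradIn hν hu h0 hC (r.s i) a (r.coordDeriv_mem_Z i a)).const_mul
      (1 / 2 : ℝ)
    simpa only [Finset.sum_const_zero, mul_zero] using h
  rw [Metric.tendsto_atTop']
  intro ε hε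
  have h1 := hC.eventually (ge_mem_nhds (half_pos hε))
  obtain ⟨N, h2⟩ := eventually_atTop_prod_self'.1 h1
  refine ⟨N, fun m hm => ?_⟩
  rw [dist_zero_right, Real.norm_of_nonneg (hφ.gradForm_self_nonneg _)]
  have h3 : Tendsto (fun n => ε / 2 + 2 * gradForm ν φ (u n) (u m)) atTop (𝓝 (ε / 2)) := by
    simpa using ((hcross m).const_mul 2).const_add (ε / 2)
  refine lt_of_le_of_lt (ge_of_tendsto h3 ?_) (half_lt_self hε)
  filter_upwards [eventually_ge_atTop N] with n hn
  have h4 := h2 n hn m hm.le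
  rw [hφ.gradForm_sub hν (hu n) (hu m)] at h4
  linarith [hφ.gradForm_self_nonneg (u n)]

end IsAdmissibleWeight

/-! ### The generator for the constant weight -/

theorem isAdmissibleWeight_one (hν : IsWienerMeasure ν) :
    IsAdmissibleWeight ν (1 : Path d → ℝ) 1 where
  aemeasurable := aemeasurable_const
  pos_le := ae_of_all _ fun _ => ⟨one_pos, le_rfl⟩
  integrable_div F hF := by simpa using hν.integrable_of_mem_Z hF

theorem weighted_one : weighted ν (1 : Path d → ℝ) = ν := by
  simp [weighted]

/-- Exhibits the operator as `-½ ∑ ∂* (∂_{i,a} f)`, with `∂*` the adjoint from `integral_gradIn_mul`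
at time `sᵢ` in direction `a`. The second-order terms arise from the chain rule for `gradIn` at time
`sᵢ`. -/
theorem Cyl.ornsteinUhlenbeck_eq (r : Cyl d) (γ : Path d) : r.ornsteinUhlenbeck γ =
    -((1 / 2) * ∑ i, ∑ a, (r.coordDeriv i a γ * inner ℝ (γ (r.s i)) (unitVec a)
      - gradIn (r.s i) (unitVec a) (r.coordDeriv i a) γ)) := by
  have h1 : ∀ i, inner ℝ (γ (r.s i)) (r.partialGrad i (r.ev γ)) =
      ∑ a, r.coordDeriv i a γ * inner ℝ (γ (r.s i)) (unitVec a) := by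
    intro i
    rw [inner_eq_sum_unitVec]
    exact Finset.sum_congr rfl fun a _ => by
      rw [r.inner_partialGrad, mul_comm, Cyl.coordDeriv]
  have h2 : ∀ j a, gradIn (r.s j) (unitVec a) (r.coordDeriv j a) γ =
      ∑ i, min (r.s i : ℝ) (r.s j : ℝ) *
        fderiv ℝ (fun x => fderiv ℝ r.f x (Pi.single j (unitVec a))) (r.ev γ)
          (Pi.single i (unitVec a)) := by
    intro j a
    refine (gradIn_of_finite r.s (r.f_growth.fderiv_apply (Pi.single j (unitVec a)))
      (r.s j) (unitVec a) γ).trans ?_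
    have : (fun i => min (r.s i : ℝ) (r.s j : ℝ) • unitVec a) =
        ∑ i, min (r.s i : ℝ) (r.s j : ℝ) • (Pi.single i (unitVec a) : Fin (r.n + 1) → Euc d) := by
      ext k : 1
      simp [Finset.sum_apply, Pi.single_apply]
    rw [this, map_sum]
    exact Finset.sum_congr rfl fun i _ => by rw [map_smul, smul_eq_mul]; rfl
  rw [Cyl.ornsteinUhlenbeck, Finset.sum_congr rfl fun i _ => h1 i]
  simp only [h2, Finset.sum_sub_distrib, Finset.mul_sum (s := (Finset.univ : Finset (Fin d)))]
  rw [Finset.sum_comm, Finset.sum_congr rfl fun j _ => Finset.sum_comm]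
  ring

theorem Cyl.ornsteinUhlenbeck_mem_Z (r : Cyl d) : r.ornsteinUhlenbeck ∈ Z d := by
  rw [funext r.ornsteinUhlenbeck_eq]
  refine (Z d).neg_mem ((Z d).smul_mem (1 / 2 : ℝ) (sum_mem_Z _ fun i _ => sum_mem_Z _ fun a _ =>
    (Z d).sub_mem (mul_mem_Z (r.coordDeriv_mem_Z i a) (inner_eval_mem_Z _ _))
      (gradIn_mem_Z (r.coordDeriv_mem_Z i a) _ _)))

theorem gradForm_one_toFun (hν : IsWienerMeasure ν) (r : Cyl d) {v : Path d → ℝ}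
    (hv : v ∈ Z d) : gradForm ν 1 r.toFun v = -∫ γ, r.ornsteinUhlenbeck γ * v γ ∂ν := by
  have hcomm : gradForm ν 1 r.toFun v = gradForm ν 1 v r.toFun := by
    simp only [gradForm, cmInner_comm]
  have hi : ∀ i a, Integrable (fun γ => v γ * (r.coordDeriv i a γ *
      inner ℝ (γ (r.s i)) (unitVec a) - gradIn (r.s i) (unitVec a) (r.coordDeriv i a) γ)) ν :=
    fun i a => hν.integrable_of_mem_Z (mul_mem_Z hv ((Z d).sub_mem
      (mul_mem_Z (r.coordDeriv_mem_Z i a) (inner_eval_mem_Z _ _))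
      (gradIn_mem_Z (r.coordDeriv_mem_Z i a) _ _)))
  rw [hcomm, (isAdmissibleWeight_one hν).gradForm_eq_sum hν hv r, ← integral_neg]
  simp only [Pi.one_apply, mul_one, hν.integral_gradIn_mul hv (r.coordDeriv_mem_Z _ _)]
  have e : ∀ γ, -(r.ornsteinUhlenbeck γ * v γ) = (1 / 2) * ∑ i, ∑ a, v γ *
      (r.coordDeriv i a γ * inner ℝ (γ (r.s i)) (unitVec a)
        - gradIn (r.s i) (unitVec a) (r.coordDeriv i a) γ) := by
    intro γ
    simp only [← Finset.mul_sum]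
    rw [r.ornsteinUhlenbeck_eq]
    ring
  rw [integral_congr_ae (ae_of_all _ e), integral_const_mul,
    integral_finsetSum _ fun i _ => integrable_finsetSum _ fun a _ => hi i a]
  congr 1
  exact Finset.sum_congr rfl fun i _ => (integral_finsetSum _ fun a _ => hi i a).symm

theorem isGenerator_ornsteinUhlenbeck (hν : IsWienerMeasure ν) (r : Cyl d) :
    IsGenerator ν (Z d) (gradForm ν 1) r.toFun r.ornsteinUhlenbeck := by
  have h1 := isAdmissibleWeight_one hν
  have hL2 : ∀ F ∈ Z d, MemLp F 2 ν := fun F hF => by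
    simpa only [weighted_one] using h1.memLp_two hν hF
  have hr : r.toFun ∈ Z d := ⟨r, rfl⟩
  -- The function already lies in the form core, so a constant approximating sequence suffices.
  refine ⟨hL2 _ hr, hL2 _ r.ornsteinUhlenbeck_mem_Z, fun _ => r.toFun, fun _ => hr, ?_, ?_,
    fun v hv => ?_⟩
  · simp [TendstoL2]
  · have h := h1.gradForm_sub hν hr hr
    have h0 : gradForm ν 1 (r.toFun - r.toFun) (r.toFun - r.toFun) = 0 := by rw [h]; ring
    simp only [FormCauchy, h0]
    exact tendsto_const_nhds
  · simp only [gradForm_one_toFun hν r hv]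
    exact tendsto_const_nhds

end WienerForm

end

theorem mainTheorem9 (d : ℕ) (ν : Measure (WienerForm.Path d))
    (hν : WienerForm.IsWienerMeasure ν) :
    (∀ (φ : WienerForm.Path d → ℝ), AEMeasurable φ ν →
      ∀ c : ℝ, (∀ᵐ γ ∂ν, 0 < φ γ ∧ φ γ ≤ c) →
      (∀ F ∈ WienerForm.Z d, Integrable (fun γ => F γ / φ γ) ν) →
        (∀ F ∈ WienerForm.Z d, MemLp F 2 (WienerForm.weighted ν φ)) ∧
        (∀ F ∈ WienerForm.Z d, ∀ G ∈ WienerForm.Z d,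
          Integrable (fun γ => WienerForm.cmInner (WienerForm.malliavinGrad F γ)
            (WienerForm.malliavinGrad G γ) * φ γ) ν) ∧
        WienerForm.IsClosable (WienerForm.weighted ν φ) (WienerForm.Z d)
          (WienerForm.gradForm ν φ)) ∧
    (∀ r : WienerForm.Cyl d,
      WienerForm.IsGenerator ν (WienerForm.Z d) (WienerForm.gradForm ν 1)
        r.toFun r.ornsteinUhlenbeck) := by
  refine ⟨fun φ hm c hpos hdiv => ?_, WienerForm.isGenerator_ornsteinUhlenbeck hν⟩
  have hφ : WienerForm.IsAdmissibleWeight ν φ c := ⟨hm, hpos, hdiv⟩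
  exact ⟨fun F hF => hφ.memLp_two hν hF, fun F hF G hG => hφ.integrable_inner_grad hν hF hG,
    hφ.isClosable hν⟩
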